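/- Let $M$ be a smooth manifold of dimension $n=2m$, $m\ge 2$, with a smooth pseudo-Riemannian metric $g$ of arbitrary signature, Levi-Civita connection $\nabla$ and Weyl tensor $C$. Let $\phi$ be a conformal Killing--Yano tensor, i.e. a smooth real $2$-form for which there are a $3$-form $\tau$ and a $1$-form $K$ with $$\nabla_c\phi_{ab}=\tau_{cab}+\frac{2}{n-1}\,g_{c[a}K_{b]} .$$ Assume that at every point $\phi$ is non-degenerate and the endomorphism $\phi^a{}_b=g^{ac}\phi_{cb}$ has $2m$ distinct complex eigenvalues. A *diagonalising null frame* at $p$ is a basis $\{\theta^\mu,\theta_\mu\}_{\mu=1}^m$ of the complexified cotangent space with $g=\sum_\mu(\theta^\mu\otimes\theta_\mu+\theta_\mu\otimes\theta^\mu)$ and $\phi=\sum_\mu\lambda_\mu(\theta^\mu\otimes\theta_\mu-\theta_\mu\otimes\theta^\mu)$; its dual basis is $\{V_a\}=\{V_\mu,V^\mu\}$. A non-zero (complex) null vector $\ell$ at $p$ is a *Weyl aligned null direction* (WAND) if $C(\ell,X,\ell,Y)=0$ for all $X,Y\perp\ell$. For a null pair $\ell,k$ with $g(\ell,k)=1$,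 *$C$ has only components of boost weight zero relative to $(\ell,k)$* if for all $X,Y,Z$ orthogonal to $\ell$ and $k$ $$C(\ell,X,\ell,Y)=C(\ell,k,\ell,X)=C(\ell,X,Y,Z)=0,$$ and the same holds with $\ell$ and $k$ exchanged. If $\ell,k$ can be chosen real and $C_p\neq0$, then $C$ is *of type D* at $p$. 1. (Any signature.) Let $N\subset M$ be the set of points at which every non-zero eigenvalue of the endomorphism induced by $\phi$ on $2$-forms is simple: if $\alpha\ne\beta$ and $\gamma\neq\delta$ are eigenvalues of $\phi^a{}_b$ with $\alpha+\beta=\gamma+\delta\ne0$, then $\{\alpha,\beta\}=\{\gamma,\delta\}$. At every point of the closure of $N$ and for every diagonalising null frame, each of the $2m$ basis vectors $V_a$ is a WAND, and for each $\mu$ the Weyl tensor has only components of boost weight zero relative to $(V_\mu,V^\mu)$. 2. (Lorentzian signature; no further assumption on the eigenvalues.) At every point $p$ where $g$ is Lorentzian, each diagonalising null frame contains a pair $V_\mu,V^\mu$ of (multiples of) real null vectors relative to which $C$ has only components of boost weight zero; every frame vector $V_a$ that is a multiple of a real vector is a WAND; and $C$ is of type D at $p$ or $C_p=0$. -/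

import Mathlib

open scoped Manifold ContDiff

noncomputable section

namespace CKY

/-- Coordinate space `ℝⁿ`, the model of an `n`-dimensional manifold. -/
abbrev Coord (n : ℕ) := EuclideanSpace ℝ (Fin n)

/-! ### Metrics and two-forms on a smooth manifold, and their components in a chart -/

section Manifold

variable {n : ℕ} {M : Type*} [TopologicalSpace M] [ChartedSpace (Coord n) M]

/-- The coordinate vector `∂/∂xⁱ` of the chart `e`, at the point with coordinates `x`. -/
def coordVec (e : OpenPartialHomeomorph M (Coord n)) (x : Coord n) (i : Fin n) :
    TangentSpace (𝓡 n) (e.symm x) :=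
  mfderiv (𝓡 n) (𝓡 n) e.symm x
    (show TangentSpace (𝓡 n) x from EuclideanSpace.single i (1 : ℝ))

/-- The components `B(∂ᵢ, ∂ⱼ)` in the chart `e` of a field `B` of bilinear forms on the tangent
spaces of `M`, as a matrix-valued function of the coordinates (meaningful on `e.target`). -/
def comp (B : ∀ p : M, LinearMap.BilinForm ℝ (TangentSpace (𝓡 n) p))
    (e : OpenPartialHomeomorph M (Coord n)) (x : Coord n) : Matrix (Fin n) (Fin n) ℝ :=
  Matrix.of fun i j => B (e.symm x) (coordVec e x i) (coordVec e x j)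

end Manifold

/-- A smooth pseudo-Riemannian metric (of arbitrary signature) on the `n`-manifold `M`. -/
structure Metric (n : ℕ) (M : Type*) [TopologicalSpace M] [ChartedSpace (Coord n) M] where
  form : ∀ p : M, LinearMap.BilinForm ℝ (TangentSpace (𝓡 n) p)
  symm : ∀ (p : M) (X Y : TangentSpace (𝓡 n) p), form p X Y = form p Y X
  nondeg : ∀ (p : M) (X : TangentSpace (𝓡 n) p), (∀ Y, form p X Y = 0) → X = 0
  smooth : ∀ e ∈ atlas (Coord n) M, ∀ i j : Fin n,
    ContDiffOn ℝ ∞ (fun x => comp form e x i j) e.target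

/-- A smooth (real) differential `2`-form on the `n`-manifold `M`. -/
structure TwoForm (n : ℕ) (M : Type*) [TopologicalSpace M] [ChartedSpace (Coord n) M] where
  form : ∀ p : M, LinearMap.BilinForm ℝ (TangentSpace (𝓡 n) p)
  alt : ∀ (p : M) (X : TangentSpace (𝓡 n) p), form p X X = 0
  smooth : ∀ e ∈ atlas (Coord n) M, ∀ i j : Fin n,
    ContDiffOn ℝ ∞ (fun x => comp form e x i j) e.target

/-! ### Levi-Civita connection and curvature in coordinates

Here `G` is the matrix of components of a metric, as a function of the coordinates. -/

section Local

variable {n : ℕ}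

/-- The partial derivative `∂ᵢ f` at `x`. -/
def pderiv (i : Fin n) (f : Coord n → ℝ) (x : Coord n) : ℝ :=
  fderiv ℝ f x (EuclideanSpace.single i (1 : ℝ))

/-- The Christoffel symbol `Γᵏᵢⱼ` of the Levi-Civita connection. -/
def christoffel (G : Coord n → Matrix (Fin n) (Fin n) ℝ) (k i j : Fin n) (x : Coord n) : ℝ :=
  (1 / 2) * ∑ l, (G x)⁻¹ k l *
    (pderiv i (fun y => G y l j) x + pderiv j (fun y => G y l i) x - pderiv l (fun y => G y i j) x)

/-- The components `(∇φ)_{cab} = ∇_c φ_{ab}` of the Levi-Civita covariant derivative of a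
covariant `2`-tensor with components `Φ`. -/
def covDeriv (G Φ : Coord n → Matrix (Fin n) (Fin n) ℝ) (c a b : Fin n) (x : Coord n) : ℝ :=
  pderiv c (fun y => Φ y a b) x
    - ∑ k, christoffel G k c a x * Φ x k b - ∑ k, christoffel G k c b x * Φ x a k

/-- The Riemann tensor `Rᵏ_{lij}`, the `∂ₖ`-component of `R(∂ᵢ, ∂ⱼ)∂ₗ`. -/
def riemannUp (G : Coord n → Matrix (Fin n) (Fin n) ℝ) (k l i j : Fin n) (x : Coord n) : ℝ :=
  pderiv i (christoffel G k j l) x - pderiv j (christoffel G k i l) x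
    + ∑ r, (christoffel G k i r x * christoffel G r j l x
        - christoffel G k j r x * christoffel G r i l x)

/-- The Riemann tensor `R_{abcd} = g_{ak} Rᵏ_{bcd}`. -/
def riemann (G : Coord n → Matrix (Fin n) (Fin n) ℝ) (a b c d : Fin n) (x : Coord n) : ℝ :=
  ∑ k, G x a k * riemannUp G k b c d x

/-- The Ricci tensor `R_{bd} = Rᵏ_{bkd}`. -/
def ricci (G : Coord n → Matrix (Fin n) (Fin n) ℝ) (b d : Fin n) (x : Coord n) : ℝ :=
  ∑ k, riemannUp G k b k d x

/-- The scalar curvature. -/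
def scalarCurv (G : Coord n → Matrix (Fin n) (Fin n) ℝ) (x : Coord n) : ℝ :=
  ∑ b, ∑ d, (G x)⁻¹ b d * ricci G b d x

/-- The Weyl conformal tensor `C_{abcd}` (for `n ≥ 3`). -/
def weyl (G : Coord n → Matrix (Fin n) (Fin n) ℝ) (x : Coord n) (a b c d : Fin n) : ℝ :=
  riemann G a b c d x
    - 1 / ((n : ℝ) - 2) * (G x a c * ricci G b d x - G x a d * ricci G b c x
        - G x b c * ricci G a d x + G x b d * ricci G a c x)
    + scalarCurv G x / (((n : ℝ) - 1) * ((n : ℝ) - 2)) * (G x a c * G x b d - G x a d * G x b c)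

/-- The conformal Killing-Yano equation at `x`:
`∇_c φ_{ab} = τ_{cab} + (2 / (n - 1)) g_{c[a} K_{b]}` for a `3`-form `τ` and a `1`-form `K`
(which are then determined by the equation). -/
def CKYEquationAt (G Φ : Coord n → Matrix (Fin n) (Fin n) ℝ) (x : Coord n) : Prop :=
  ∃ (τ : Fin n → Fin n → Fin n → ℝ) (K : Fin n → ℝ),
    (∀ c a b, τ c a b = -τ a c b) ∧ (∀ c a b, τ c a b = -τ c b a) ∧
    ∀ c a b, covDeriv G Φ c a b x
      = τ c a b + 1 / ((n : ℝ) - 1) * (G x c a * K b - G x c b * K a)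

end Local

/-- `φ` is a conformal Killing-Yano tensor (conformal Killing `2`-form) of `(M, g)`. -/
def IsConformalKillingYano {n : ℕ} {M : Type*} [TopologicalSpace M] [ChartedSpace (Coord n) M]
    (g : Metric n M) (φ : TwoForm n M) : Prop :=
  ∀ e ∈ atlas (Coord n) M, ∀ x ∈ e.target, CKYEquationAt (comp g.form e) (comp φ.form e) x

/-! ### Algebra in one (complexified) tangent space

From here on `G` and `Φ` are the component matrices at one point of a metric and of a `2`-form, `W`
are the components of the Weyl tensor there, and complexified tangent vectors and covectors are
given by their components `Fin n → ℂ`. -/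

section Pointwise

variable {n : ℕ}

/-- The complex bilinear extension of a real bilinear form. -/
def bilin (G : Matrix (Fin n) (Fin n) ℝ) (u v : Fin n → ℂ) : ℂ :=
  ∑ i, ∑ j, (G i j : ℂ) * u i * v j

/-- The complex multilinear extension of a real covariant `4`-tensor. -/
def quad (W : Fin n → Fin n → Fin n → Fin n → ℝ) (u v w z : Fin n → ℂ) : ℂ :=
  ∑ i, ∑ j, ∑ k, ∑ l, (W i j k l : ℂ) * u i * v j * w k * z l

/-- The (complex) eigenvalues of the endomorphism `φᵃ_b = gᵃᶜ φ_{cb}`. -/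
def eigenvalues (G Φ : Matrix (Fin n) (Fin n) ℝ) : Set ℂ :=
  spectrum ℂ ((G⁻¹ * Φ).map (fun r : ℝ => (r : ℂ)))

/-- `φ` is non-degenerate and has `n` distinct eigenvalues. -/
def NondegenerateDistinct (G Φ : Matrix (Fin n) (Fin n) ℝ) : Prop :=
  Φ.det ≠ 0 ∧ (eigenvalues G Φ).ncard = n

/-- The non-zero eigenvalues `α + β` (`α ≠ β` eigenvalues of `φ`) of the induced endomorphism of
the space of `2`-forms are simple. -/
def SimpleOnTwoForms (G Φ : Matrix (Fin n) (Fin n) ℝ) : Prop :=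
  ∀ α ∈ eigenvalues G Φ, ∀ β ∈ eigenvalues G Φ, ∀ γ ∈ eigenvalues G Φ, ∀ δ ∈ eigenvalues G Φ,
    α ≠ β → γ ≠ δ → α + β ≠ 0 → α + β = γ + δ → (α = γ ∧ β = δ) ∨ (α = δ ∧ β = γ)

/-- A null coframe in which `φ` is diagonal, with its dual frame. The index `Sum.inl μ` stands for
`θ^μ` and the dual vector `V_μ`; the index `Sum.inr μ` stands for `θ_μ` and the dual vector `V^μ`. -/
structure NullDiagonalFrame (m : ℕ) (G Φ : Matrix (Fin (2 * m)) (Fin (2 * m)) ℝ) where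
  θ : Fin m ⊕ Fin m → Fin (2 * m) → ℂ
  V : Fin m ⊕ Fin m → Fin (2 * m) → ℂ
  eig : Fin m → ℂ
  dual : ∀ a b, ∑ i, θ a i * V b i = if a = b then 1 else 0
  metric_eq : ∀ i j, (G i j : ℂ) =
    ∑ μ, (θ (Sum.inl μ) i * θ (Sum.inr μ) j + θ (Sum.inr μ) i * θ (Sum.inl μ) j)
  form_eq : ∀ i j, (Φ i j : ℂ) =
    ∑ μ, eig μ * (θ (Sum.inl μ) i * θ (Sum.inr μ) j - θ (Sum.inr μ) i * θ (Sum.inl μ) j)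

/-- `l` is a Weyl aligned null direction: `l` is null and non-zero and the components
`C(l, X, l, Y)`, with `X`, `Y` orthogonal to `l`, of leading boost weight vanish. -/
def IsWAND (G : Matrix (Fin n) (Fin n) ℝ) (W : Fin n → Fin n → Fin n → Fin n → ℝ)
    (l : Fin n → ℂ) : Prop :=
  l ≠ 0 ∧ bilin G l l = 0 ∧
    ∀ X Y, bilin G l X = 0 → bilin G l Y = 0 → quad W l X l Y = 0

/-- The components of boost weight `2` and `1` relative to the null pair `l`, `k` vanish. -/
def NoPositiveBoost (G : Matrix (Fin n) (Fin n) ℝ) (W : Fin n → Fin n → Fin n → Fin n → ℝ)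
    (l k : Fin n → ℂ) : Prop :=
  ∀ X Y Z, bilin G l X = 0 → bilin G k X = 0 → bilin G l Y = 0 → bilin G k Y = 0 →
    bilin G l Z = 0 → bilin G k Z = 0 →
    quad W l X l Y = 0 ∧ quad W l k l X = 0 ∧ quad W l X Y Z = 0

/-- `l`, `k` is a normalised null pair relative to which all components of `C` of non-zero boost
weight vanish. -/
def IsTypeDPair (G : Matrix (Fin n) (Fin n) ℝ) (W : Fin n → Fin n → Fin n → Fin n → ℝ)
    (l k : Fin n → ℂ) : Prop :=
  bilin G l l = 0 ∧ bilin G k k = 0 ∧ bilin G l k = 1 ∧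
    NoPositiveBoost G W l k ∧ NoPositiveBoost G W k l

/-- A real vector regarded as a complexified one. -/
def toComplex (l : Fin n → ℝ) : Fin n → ℂ := fun i => (l i : ℂ)

/-- `v` spans the complexification of a real direction. -/
def IsRealDirection (v : Fin n → ℂ) : Prop :=
  ∃ (c : ℂ) (l : Fin n → ℝ), c ≠ 0 ∧ l ≠ 0 ∧ v = c • toComplex l

/-- The Weyl tensor is of type D: it is non-zero, and it has only components of boost weight zero
relative to some pair of real null vectors. -/
def IsTypeD (G : Matrix (Fin n) (Fin n) ℝ) (W : Fin n → Fin n → Fin n → Fin n → ℝ) : Prop :=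
  W ≠ 0 ∧ ∃ l k : Fin n → ℝ, IsTypeDPair G W (toComplex l) (toComplex k)

/-- Lorentzian signature, in either sign convention. -/
def IsLorentzian (G : Matrix (Fin n) (Fin n) ℝ) : Prop :=
  ∃ (s : ℝ) (P : Matrix (Fin n) (Fin n) ℝ), (s = 1 ∨ s = -1) ∧ P.det ≠ 0 ∧
    P.transpose * G * P = s • Matrix.diagonal (fun i : Fin n => if i.val = 0 then (1 : ℝ) else -1)

end Pointwise

end CKY

end

/-!
Differentiating the conformal Killing-Yano equation and applying the Ricci identity shows that the
derivation action of `A = g⁻¹φ` on the Riemann tensor is a Kulkarni-Nomizu product `g ∧ N`. The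
action on the Ricci part of the curvature is of that form too. So the action on the Weyl tensor `C`
is pure trace, but it is also trace-free because `C` is: it vanishes. On eigenvectors `V_a` of `φ`,
with eigenvalues `λ_a`, this says that `C(V_a, V_b, V_c, V_d) = 0` unless
`λ_a + λ_b + λ_c + λ_d = 0`.

The eigenvalues come in pairs `±λ`, so this exceptional equation reads `λ_a + λ_b = γ + δ` with
`γ = -λ_c` and `δ = -λ_d` again eigenvalues. Simplicity on `2`-forms then forces `V_c` or `V_d` to
be the null partner of `V_a`, which is what does not occur in the components in question. Since the
eigenvalues are distinct, the eigenvectors of a limit point are limits of eigenvectors, and the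
conclusion persists on the closure.

In Lorentzian signature the conjugate of a null eigenvector whose eigenvalue is not imaginary is
null and orthogonal to it, hence proportional to it. Two real null directions are orthogonal only if
they coincide, so exactly one pair `±λ` is not imaginary, and for `λ_a` in that pair the real part
of `λ_a + λ_b + λ_c + λ_d` takes over the role of simplicity.
-/

noncomputable section

namespace CKY

open Filter Topology Matrix

/-! ### Partial derivatives of functions and of matrices of functions -/

section PartialDerivatives

variable {n : ℕ} {U : Set (Coord n)} {f h : Coord n → ℝ} {x : Coord n}

theorem contDiffOn_pderiv (hU : IsOpen U) (hf : ContDiffOn ℝ ∞ f U) (i : Fin n) :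
    ContDiffOn ℝ ∞ (pderiv i f) U :=
  (hf.fderiv_of_isOpen hU (by simp)).clm_apply contDiffOn_const

theorem differentiableAt_of_contDiffOn (hU : IsOpen U) (hf : ContDiffOn ℝ ∞ f U) (hx : x ∈ U) :
    DifferentiableAt ℝ f x :=
  (hf.contDiffAt (hU.mem_nhds hx)).differentiableAt (by simp)

theorem pderiv_comm (hU : IsOpen U) (hf : ContDiffOn ℝ ∞ f U) (hx : x ∈ U) (i j : Fin n) :
    pderiv i (pderiv j f) x = pderiv j (pderiv i f) x := by
  have hfx := hf.contDiffAt (hU.mem_nhds hx)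
  have hf' : DifferentiableAt ℝ (fderiv ℝ f) x :=
    (hfx.fderiv_right (m := 1) (by norm_cast)).differentiableAt (by simp)
  have second_deriv (k l : Fin n) : pderiv k (pderiv l f) x
      = fderiv ℝ (fderiv ℝ f) x (EuclideanSpace.single k 1) (EuclideanSpace.single l 1) := by
    change fderiv ℝ (fun y => fderiv ℝ f y (EuclideanSpace.single l 1)) x _ = _
    simp [fderiv_clm_apply hf' (differentiableAt_const _)]
  rw [second_deriv, second_deriv]
  exact hfx.isSymmSndFDerivAt (by simp; norm_cast) _ _

theorem pderiv_congr (hU : IsOpen U) (hfh : Set.EqOn f h U) (hx : x ∈ U) (i : Fin n) :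
    pderiv i f x = pderiv i h x := by
  simp only [pderiv, (hfh.eventuallyEq_of_mem (hU.mem_nhds hx)).fderiv_eq]

theorem pderiv_const (c : ℝ) (i : Fin n) : pderiv i (fun _ => c) x = 0 := by
  simp [pderiv]

theorem pderiv_neg (i : Fin n) : pderiv i (fun y => -f y) x = -pderiv i f x := by
  simp [pderiv, fderiv_fun_neg]

theorem pderiv_add (hf : DifferentiableAt ℝ f x) (hh : DifferentiableAt ℝ h x) (i : Fin n) :
    pderiv i (fun y => f y + h y) x = pderiv i f x + pderiv i h x := by
  simp [pderiv, fderiv_fun_add hf hh]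

theorem pderiv_sub (hf : DifferentiableAt ℝ f x) (hh : DifferentiableAt ℝ h x) (i : Fin n) :
    pderiv i (fun y => f y - h y) x = pderiv i f x - pderiv i h x := by
  simp [pderiv, fderiv_fun_sub hf hh]

theorem pderiv_mul (hf : DifferentiableAt ℝ f x) (hh : DifferentiableAt ℝ h x) (i : Fin n) :
    pderiv i (fun y => f y * h y) x = pderiv i f x * h x + f x * pderiv i h x := by
  simp [pderiv, fderiv_fun_mul hf hh]
  ring

theorem pderiv_const_mul (hf : DifferentiableAt ℝ f x) (c : ℝ) (i : Fin n) :
    pderiv i (fun y => c * f y) x = c * pderiv i f x := by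
  simp [pderiv, fderiv_const_mul hf]

theorem pderiv_sum {κ : Type*} (s : Finset κ) {F : κ → Coord n → ℝ}
    (hF : ∀ k ∈ s, DifferentiableAt ℝ (F k) x) (i : Fin n) :
    pderiv i (fun y => ∑ k ∈ s, F k y) x = ∑ k ∈ s, pderiv i (F k) x := by
  simp [pderiv, fderiv_fun_sum hF]

variable {ι κ ν : Type*}

/-- The entrywise partial derivative of a matrix-valued function. -/
def pderivMatrix (i : Fin n) (B : Coord n → Matrix ι κ ℝ) (x : Coord n) : Matrix ι κ ℝ :=
  Matrix.of fun a b => pderiv i (fun y => B y a b) x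

/-- Smoothness of a matrix-valued function, stated entrywise so that no norm on matrices has to be
chosen. -/
def EntrywiseSmoothOn (B : Coord n → Matrix ι κ ℝ) (U : Set (Coord n)) : Prop :=
  ∀ a b, ContDiffOn ℝ ∞ (fun y => B y a b) U

namespace EntrywiseSmoothOn

variable {B : Coord n → Matrix ι κ ℝ}

theorem differentiableAt (hB : EntrywiseSmoothOn B U) (hU : IsOpen U) (hx : x ∈ U) (a : ι)
    (b : κ) : DifferentiableAt ℝ (fun y => B y a b) x :=
  differentiableAt_of_contDiffOn hU (hB a b) hx

theorem tendsto (hB : EntrywiseSmoothOn B U) (hU : IsOpen U) (hx : x ∈ U) (a : ι) (b : κ) :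
    Tendsto (fun y => B y a b) (𝓝 x) (𝓝 (B x a b)) :=
  (hB.differentiableAt hU hx a b).continuousAt

theorem pderivMatrix (hB : EntrywiseSmoothOn B U) (hU : IsOpen U) (i : Fin n) :
    EntrywiseSmoothOn (pderivMatrix i B) U :=
  fun a b => contDiffOn_pderiv hU (hB a b) i

theorem transpose (hB : EntrywiseSmoothOn B U) : EntrywiseSmoothOn (fun y => (B y)ᵀ) U :=
  fun a b => hB b a

theorem sub {C : Coord n → Matrix ι κ ℝ} (hB : EntrywiseSmoothOn B U)
    (hC : EntrywiseSmoothOn C U) : EntrywiseSmoothOn (fun y => B y - C y) U :=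
  fun a b => (hB a b).sub (hC a b)

theorem mul [Fintype κ] {C : Coord n → Matrix κ ν ℝ} (hB : EntrywiseSmoothOn B U)
    (hC : EntrywiseSmoothOn C U) : EntrywiseSmoothOn (fun y => B y * C y) U := fun a b => by
  simp only [Matrix.mul_apply]
  exact ContDiffOn.sum fun k _ => (hB a k).mul (hC k b)

variable [Fintype ι] [DecidableEq ι] {S : Coord n → Matrix ι ι ℝ}

theorem det (hS : EntrywiseSmoothOn S U) : ContDiffOn ℝ ∞ (fun y => (S y).det) U := by
  simp only [Matrix.det_apply']
  exact ContDiffOn.sum fun σ _ => contDiffOn_const.mul (contDiffOn_prod fun i _ => hS _ _)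

theorem inv (hS : EntrywiseSmoothOn S U) (hdet : ∀ y ∈ U, (S y).det ≠ 0) :
    EntrywiseSmoothOn (fun y => (S y)⁻¹) U := fun a b => by
  have cramer (y) : (S y)⁻¹ a b = ((S y).det)⁻¹ * ((S y).updateRow b (Pi.single a 1)).det := by
    rw [Matrix.inv_def, Matrix.smul_apply, Matrix.adjugate_apply, smul_eq_mul,
      Ring.inverse_eq_inv']
  simp only [cramer]
  refine (hS.det.inv hdet).mul (EntrywiseSmoothOn.det fun i j => ?_)
  obtain rfl | h := eq_or_ne i b
  · simpa using contDiffOn_const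
  · simpa [Matrix.updateRow_ne h] using hS i j

end EntrywiseSmoothOn

section

variable {B C : Coord n → Matrix ι κ ℝ}

theorem pderivMatrix_sub (hB : EntrywiseSmoothOn B U) (hC : EntrywiseSmoothOn C U)
    (hU : IsOpen U) (hx : x ∈ U) (i : Fin n) :
    pderivMatrix i (fun y => B y - C y) x = pderivMatrix i B x - pderivMatrix i C x := by
  ext a b
  exact pderiv_sub (hB.differentiableAt hU hx a b) (hC.differentiableAt hU hx a b) i

theorem pderivMatrix_transpose (i : Fin n) :
    pderivMatrix i (fun y => (B y)ᵀ) x = (pderivMatrix i B x)ᵀ := rfl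

theorem pderivMatrix_comm (hB : EntrywiseSmoothOn B U) (hU : IsOpen U) (hx : x ∈ U)
    (i j : Fin n) :
    pderivMatrix i (pderivMatrix j B) x = pderivMatrix j (pderivMatrix i B) x := by
  ext a b
  exact pderiv_comm hU (hB a b) hx i j

end

theorem pderivMatrix_mul [Fintype κ] {B : Coord n → Matrix ι κ ℝ} {C : Coord n → Matrix κ ν ℝ}
    (hB : EntrywiseSmoothOn B U) (hC : EntrywiseSmoothOn C U) (hU : IsOpen U) (hx : x ∈ U)
    (i : Fin n) :
    pderivMatrix i (fun y => B y * C y) x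
      = pderivMatrix i B x * C x + B x * pderivMatrix i C x := by
  have hBx := hB.differentiableAt hU hx
  have hCx := hC.differentiableAt hU hx
  ext a b
  simp only [pderivMatrix, Matrix.mul_apply, Matrix.add_apply, Matrix.of_apply]
  rw [pderiv_sum _ fun k _ => (hBx a k).fun_mul (hCx k b), ← Finset.sum_add_distrib]
  exact Finset.sum_congr rfl fun k _ => pderiv_mul (hBx a k) (hCx k b) i

end PartialDerivatives

/-! ### Algebra of curvature-like tensors -/

section CurvatureLike

variable {ι : Type*}

/-- The first Bianchi identity for a covariant `4`-tensor, in its last three indices. -/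
def SatisfiesBianchi (R : ι → ι → ι → ι → ℝ) : Prop :=
  ∀ a b c d, R a b c d + R a c d b + R a d b c = 0

theorem pair_symm_of_satisfiesBianchi {R : ι → ι → ι → ι → ℝ}
    (left : ∀ a b c d, R a b c d = -R b a c d) (right : ∀ a b c d, R a b c d = -R a b d c)
    (bianchi : SatisfiesBianchi R) (a b c d : ι) : R a b c d = R c d a b := by
  linarith [bianchi a b c d, bianchi b c d a, bianchi c d a b, bianchi d a b c, left a b c d,
    left c d a b, left b c d a, left b d a c, left b a c d, left c a b d, left c b d a,
    left d a b c, left d b c a, left d c a b, right a b c d, right a c d b, right a d b c,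
    right b c d a, right b d a c, right c d a b, right c a b d, right c b d a, right d a b c,
    right d b c a, right d c a b, right b a c d]

theorem SatisfiesBianchi.sub {R R' : ι → ι → ι → ι → ℝ} (hR : SatisfiesBianchi R)
    (hR' : SatisfiesBianchi R') : SatisfiesBianchi (R - R') := fun a b c d => by
  simp only [Pi.sub_apply]
  linear_combination hR a b c d - hR' a b c d

/-- The Kulkarni-Nomizu product of two `2`-tensors. -/
def kulkarniNomizu (P Q : Matrix ι ι ℝ) (a b c d : ι) : ℝ :=
  P a c * Q b d - P a d * Q b c - P b c * Q a d + P b d * Q a c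

theorem kulkarniNomizu_zero_left (Q : Matrix ι ι ℝ) : kulkarniNomizu 0 Q = 0 := by
  ext a b c d
  simp [kulkarniNomizu]

theorem kulkarniNomizu_zero_right (P : Matrix ι ι ℝ) : kulkarniNomizu P 0 = 0 := by
  ext a b c d
  simp [kulkarniNomizu]

theorem kulkarniNomizu_sub (P Q Q' : Matrix ι ι ℝ) :
    kulkarniNomizu P (Q - Q') = kulkarniNomizu P Q - kulkarniNomizu P Q' := by
  ext a b c d
  simp only [kulkarniNomizu, Matrix.sub_apply, Pi.sub_apply]
  ring

theorem kulkarniNomizu_bianchi {P Q : Matrix ι ι ℝ} (hP : P.IsSymm) (hQ : Q.IsSymm) :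
    SatisfiesBianchi (kulkarniNomizu P Q) := fun a b c d => by
  simp only [kulkarniNomizu]
  rw [hP.apply b c, hQ.apply b c, hP.apply b d, hQ.apply b d, hP.apply c d, hQ.apply c d]
  ring

variable [Fintype ι]

/-- The derivation action `AᵀP + PA` of an endomorphism `A` on a covariant `2`-tensor. -/
def formAct (A P : Matrix ι ι ℝ) : Matrix ι ι ℝ :=
  Aᵀ * P + P * A

/-- The derivation action of an endomorphism `A` on covariant `4`-tensors. -/
def tensorAct (A : Matrix ι ι ℝ) (R : ι → ι → ι → ι → ℝ) (a b c d : ι) : ℝ :=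
  ∑ e, (A e a * R e b c d + A e b * R a e c d + A e c * R a b e d + A e d * R a b c e)

theorem tensorAct_sub (A : Matrix ι ι ℝ) (R R' : ι → ι → ι → ι → ℝ) :
    tensorAct A (R - R') = tensorAct A R - tensorAct A R' := by
  ext a b c d
  simp only [tensorAct, Pi.sub_apply, ← Finset.sum_sub_distrib]
  exact Finset.sum_congr rfl fun e _ => by ring

theorem SatisfiesBianchi.tensorAct {R : ι → ι → ι → ι → ℝ} (hR : SatisfiesBianchi R)
    (A : Matrix ι ι ℝ) : SatisfiesBianchi (tensorAct A R) := fun a b c d => by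
  simp only [CKY.tensorAct, ← Finset.sum_add_distrib]
  refine Finset.sum_eq_zero fun e _ => ?_
  linear_combination A e a * hR e b c d + A e b * hR a e c d + A e c * hR a b e d
    + A e d * hR a b c e

theorem tensorAct_kulkarniNomizu (A P Q : Matrix ι ι ℝ) :
    tensorAct A (kulkarniNomizu P Q)
      = kulkarniNomizu (formAct A P) Q + kulkarniNomizu P (formAct A Q) := by
  ext a b c d
  simp only [tensorAct, kulkarniNomizu, formAct, Pi.add_apply, Matrix.add_apply,
    Matrix.mul_apply, Matrix.transpose_apply, add_mul, mul_add, Finset.sum_mul, Finset.mul_sum,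
    ← Finset.sum_sub_distrib, ← Finset.sum_add_distrib]
  exact Finset.sum_congr rfl fun e _ => by ring

variable [DecidableEq ι] {S F P : Matrix ι ι ℝ}

/-- The contraction `Sᵃᶜ R_{abcd}` of a covariant `4`-tensor with the inverse of `S`. -/
def ricciContraction (S : Matrix ι ι ℝ) (R : ι → ι → ι → ι → ℝ) : Matrix ι ι ℝ :=
  Matrix.of fun b d => ∑ a, ∑ c, S⁻¹ a c * R a b c d

theorem sum_inv_mul_self (hS : S.IsSymm) (hdet : S.det ≠ 0) :
    ∑ a, ∑ c, S⁻¹ a c * S a c = Fintype.card ι := by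
  rw [← Matrix.trace_one, ← Matrix.nonsing_inv_mul S (isUnit_iff_ne_zero.2 hdet)]
  simp only [Matrix.trace, Matrix.diag, Matrix.mul_apply, hS.apply]

theorem formAct_inv_mul_eq_zero (hS : S.IsSymm) (hdet : S.det ≠ 0) (hF : Fᵀ = -F) :
    formAct (S⁻¹ * F) S = 0 := by
  have hdet' : IsUnit S.det := isUnit_iff_ne_zero.2 hdet
  rw [formAct, Matrix.transpose_mul, hS.inv, hF, Matrix.nonsing_inv_mul_cancel_right _ _ hdet',
    Matrix.mul_nonsing_inv_cancel_left _ _ hdet', neg_add_cancel]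

theorem ricciContraction_sub (R R' : ι → ι → ι → ι → ℝ) :
    ricciContraction S (R - R') = ricciContraction S R - ricciContraction S R' := by
  ext b d
  simp [ricciContraction, mul_sub, Finset.sum_sub_distrib]

theorem ricciContraction_kulkarniNomizu (hS : S.IsSymm) (hdet : S.det ≠ 0) (P : Matrix ι ι ℝ) :
    ricciContraction S (kulkarniNomizu S P)
      = ((Fintype.card ι : ℝ) - 2) • P + (S⁻¹ * P).trace • S := by
  have hdet' : IsUnit S.det := isUnit_iff_ne_zero.2 hdet
  have comm := hS.inv.apply
  ext b d
  have trace_SP : ∑ a, ∑ c, S⁻¹ a c * P a c = (S⁻¹ * P).trace := by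
    rw [Finset.sum_comm]
    simp only [Matrix.trace, Matrix.diag, Matrix.mul_apply, comm]
  have contract_right : ∑ a, ∑ c, S⁻¹ a c * (S a d * P b c) = P b d := by
    conv_rhs => rw [← Matrix.nonsing_inv_mul_cancel_right S P hdet']
    simp only [Matrix.mul_apply, Finset.sum_mul]
    exact Finset.sum_congr rfl fun a _ => Finset.sum_congr rfl fun c _ => by rw [comm a c]; ring
  have contract_left : ∑ a, ∑ c, S⁻¹ a c * (S b c * P a d) = P b d := by
    conv_rhs => rw [← Matrix.mul_nonsing_inv_cancel_left S P hdet', ← Matrix.mul_assoc]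
    simp only [Matrix.mul_apply, Finset.sum_mul]
    exact Finset.sum_congr rfl fun a _ => Finset.sum_congr rfl fun c _ => by rw [comm a c]; ring
  have expand : ricciContraction S (kulkarniNomizu S P) b d
      = (∑ a, ∑ c, S⁻¹ a c * S a c) * P b d - ∑ a, ∑ c, S⁻¹ a c * (S a d * P b c)
        - ∑ a, ∑ c, S⁻¹ a c * (S b c * P a d) + (∑ a, ∑ c, S⁻¹ a c * P a c) * S b d := by
    simp only [ricciContraction, kulkarniNomizu, Matrix.of_apply, Finset.sum_mul,
      ← Finset.sum_sub_distrib, ← Finset.sum_add_distrib]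
    exact Finset.sum_congr rfl fun a _ => Finset.sum_congr rfl fun c _ => by ring
  rw [expand, sum_inv_mul_self hS hdet, trace_SP, contract_left, contract_right]
  simp only [Matrix.add_apply, Matrix.smul_apply, smul_eq_mul]
  ring

theorem eq_zero_of_ricciContraction_kulkarniNomizu_eq_zero (hS : S.IsSymm) (hdet : S.det ≠ 0)
    (hι : 3 ≤ Fintype.card ι) (hP : ricciContraction S (kulkarniNomizu S P) = 0) : P = 0 := by
  have hn : (3 : ℝ) ≤ Fintype.card ι := by exact_mod_cast hι
  rw [ricciContraction_kulkarniNomizu hS hdet] at hP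
  have htrace : (S⁻¹ * P).trace = 0 := by
    have h := congrArg (fun Q => (S⁻¹ * Q).trace) hP
    simp only [Matrix.mul_add, Matrix.mul_smul, Matrix.trace_add, Matrix.trace_smul,
      Matrix.nonsing_inv_mul S (isUnit_iff_ne_zero.2 hdet), Matrix.trace_one, Matrix.mul_zero,
      Matrix.trace_zero, smul_eq_mul] at h
    have h' : (2 * (Fintype.card ι : ℝ) - 2) * (S⁻¹ * P).trace = 0 := by linear_combination h
    exact (mul_eq_zero.1 h').resolve_left (by linarith)
  rw [htrace, zero_smul, add_zero] at hP
  exact (smul_eq_zero.1 hP).resolve_left (by linarith)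

/-- `S⁻¹F` annihilates `S⁻¹`, so its action commutes with the contraction. -/
theorem ricciContraction_tensorAct (hS : S.IsSymm) (hF : Fᵀ = -F) (R : ι → ι → ι → ι → ℝ) :
    ricciContraction S (tensorAct (S⁻¹ * F) R)
      = formAct (S⁻¹ * F) (ricciContraction S R) := by
  set A := S⁻¹ * F with hA
  have annihilates (a c) : (A * S⁻¹) a c + (S⁻¹ * Aᵀ) a c = 0 := by
    rw [← Matrix.add_apply, hA, Matrix.transpose_mul, hS.inv, hF]
    simp [Matrix.mul_assoc]
  ext b d
  have first : ∑ a, ∑ c, S⁻¹ a c * ∑ e, A e a * R e b c d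
      = ∑ a, ∑ c, (A * S⁻¹) a c * R a b c d := by
    simp only [Matrix.mul_apply, Finset.sum_mul, Finset.mul_sum, ← mul_assoc]
    rw [Finset.sum_comm, Finset.sum_comm (f := fun a c => ∑ e, _ * _ * R a b c d)]
    refine Finset.sum_congr rfl fun c _ => Finset.sum_comm.trans ?_
    simp only [mul_comm (S⁻¹ _ _)]
  have third : ∑ a, ∑ c, S⁻¹ a c * ∑ e, A e c * R a b e d
      = ∑ a, ∑ c, (S⁻¹ * Aᵀ) a c * R a b c d := by
    simp only [Matrix.mul_apply, Finset.sum_mul, Finset.mul_sum, ← mul_assoc]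
    exact Finset.sum_congr rfl fun a _ => Finset.sum_comm
  have second : ∑ a, ∑ c, S⁻¹ a c * ∑ e, A e b * R a e c d
      = (Aᵀ * ricciContraction S R) b d := by
    simp only [ricciContraction, Matrix.mul_apply, Matrix.transpose_apply, Matrix.of_apply,
      Finset.mul_sum, mul_left_comm (S⁻¹ _ _)]
    exact (Finset.sum_congr rfl fun a _ => Finset.sum_comm).trans Finset.sum_comm
  have fourth : ∑ a, ∑ c, S⁻¹ a c * ∑ e, A e d * R a b c e
      = (ricciContraction S R * A) b d := by
    simp only [ricciContraction, Matrix.mul_apply, Matrix.of_apply, Finset.sum_mul,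
      Finset.mul_sum, mul_comm (A _ _), ← mul_assoc]
    exact (Finset.sum_congr rfl fun a _ => Finset.sum_comm).trans Finset.sum_comm
  have cancel : ∑ a, ∑ c, (A * S⁻¹) a c * R a b c d + ∑ a, ∑ c, (S⁻¹ * Aᵀ) a c * R a b c d = 0 := by
    simp only [← Finset.sum_add_distrib, ← add_mul, annihilates, zero_mul, Finset.sum_const_zero]
  simp only [ricciContraction, tensorAct, Matrix.of_apply, mul_add, Finset.sum_add_distrib,
    formAct, Matrix.add_apply] at second fourth ⊢
  rw [first, second, third, fourth]
  linear_combination cancel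

end CurvatureLike

/-! ### Curvature of the Levi-Civita connection in coordinates -/

section Connection

variable {n : ℕ} {U : Set (Coord n)} {G : Coord n → Matrix (Fin n) (Fin n) ℝ} {x : Coord n}

/-- The components, on an open set of coordinates, of a smooth pseudo-Riemannian metric. -/
structure MetricOn (G : Coord n → Matrix (Fin n) (Fin n) ℝ) (U : Set (Coord n)) : Prop where
  isOpen : IsOpen U
  smooth : EntrywiseSmoothOn G U
  isSymm : ∀ y ∈ U, (G y).IsSymm
  det_ne_zero : ∀ y ∈ U, (G y).det ≠ 0

/-- The connection matrix `(Γ_c)ᵏₐ`. -/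
def connectionMatrix (G : Coord n → Matrix (Fin n) (Fin n) ℝ) (c : Fin n) (x : Coord n) :
    Matrix (Fin n) (Fin n) ℝ :=
  Matrix.of fun k a => christoffel G k c a x

/-- The curvature endomorphism `R(∂ᵢ, ∂ⱼ)`, with entries `Rᵏ_{lij}`. -/
def curvatureMatrix (G : Coord n → Matrix (Fin n) (Fin n) ℝ) (i j : Fin n) (x : Coord n) :
    Matrix (Fin n) (Fin n) ℝ :=
  Matrix.of fun k l => riemannUp G k l i j x

/-- The covariant derivative `(∇_c B)_{ab}` of a `2`-tensor, as a matrix in `a`, `b`. -/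
def covDerivMatrix (G B : Coord n → Matrix (Fin n) (Fin n) ℝ) (c : Fin n) (x : Coord n) :
    Matrix (Fin n) (Fin n) ℝ :=
  pderivMatrix c B x - (connectionMatrix G c x)ᵀ * B x - B x * connectionMatrix G c x

/-- The covariant derivative `(∇_d K)_b` of a `1`-form. -/
def covDeriv₁ (G : Coord n → Matrix (Fin n) (Fin n) ℝ) (K : Fin n → Coord n → ℝ) (d b : Fin n)
    (x : Coord n) : ℝ :=
  pderiv d (K b) x - ∑ k, christoffel G k d b x * K k x

/-- The covariant derivative `(∇_d T)_{cab}` of a covariant `3`-tensor. -/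
def covDeriv₃ (G : Coord n → Matrix (Fin n) (Fin n) ℝ) (T : Fin n → Fin n → Fin n → Coord n → ℝ)
    (d c a b : Fin n) (x : Coord n) : ℝ :=
  pderiv d (T c a b) x - ∑ k, (christoffel G k d c x * T k a b x
    + christoffel G k d a x * T c k b x + christoffel G k d b x * T c a k x)

theorem covDerivMatrix_apply (B : Coord n → Matrix (Fin n) (Fin n) ℝ) (c a b : Fin n) :
    covDerivMatrix G B c x a b = covDeriv G B c a b x := by
  simp only [covDerivMatrix, covDeriv, pderivMatrix, connectionMatrix, Matrix.sub_apply,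
    Matrix.mul_apply, Matrix.transpose_apply, Matrix.of_apply]
  congr 1
  exact Finset.sum_congr rfl fun k _ => mul_comm _ _

theorem curvatureMatrix_eq (i j : Fin n) :
    curvatureMatrix G i j x
      = pderivMatrix i (connectionMatrix G j) x - pderivMatrix j (connectionMatrix G i) x
        + (connectionMatrix G i x * connectionMatrix G j x
          - connectionMatrix G j x * connectionMatrix G i x) := by
  ext k l
  simp [curvatureMatrix, riemannUp, pderivMatrix, connectionMatrix, Matrix.mul_apply,
    Finset.sum_sub_distrib]

theorem riemann_eq_mul_curvatureMatrix (a b c d : Fin n) :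
    riemann G a b c d x = (G x * curvatureMatrix G c d x) a b := rfl

theorem riemann_antisymm_right (a b c d : Fin n) :
    riemann G a b c d x = -riemann G a b d c x := by
  have h : curvatureMatrix G c d x = -curvatureMatrix G d c x := by
    rw [curvatureMatrix_eq, curvatureMatrix_eq]
    abel
  simp only [riemann_eq_mul_curvatureMatrix, h, Matrix.mul_neg, Matrix.neg_apply]

section CovDeriv₃

variable {T S : Fin n → Fin n → Fin n → Coord n → ℝ}

theorem covDeriv₃_congr (hU : IsOpen U) (hTS : ∀ c a b, Set.EqOn (T c a b) (S c a b) U)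
    (hx : x ∈ U) (d c a b : Fin n) : covDeriv₃ G T d c a b x = covDeriv₃ G S d c a b x := by
  simp only [covDeriv₃, pderiv_congr hU (hTS c a b) hx d, hTS _ _ _ hx]

theorem covDeriv₃_zero (d c a b : Fin n) : covDeriv₃ G (fun _ _ _ _ => 0) d c a b x = 0 := by
  simp [covDeriv₃, pderiv_const]

theorem covDeriv₃_neg (d c a b : Fin n) :
    covDeriv₃ G (fun c a b y => -T c a b y) d c a b x = -covDeriv₃ G T d c a b x := by
  simp only [covDeriv₃, pderiv_neg, mul_neg, ← neg_add, Finset.sum_neg_distrib]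
  ring

theorem covDeriv₃_swap_left (d c a b : Fin n) :
    covDeriv₃ G (fun c a b => T a c b) d c a b x = covDeriv₃ G T d a c b x := by
  unfold covDeriv₃
  congr 1
  exact Finset.sum_congr rfl fun k _ => by ring

theorem covDeriv₃_swap_right (d c a b : Fin n) :
    covDeriv₃ G (fun c a b => T c b a) d c a b x = covDeriv₃ G T d c b a x := by
  unfold covDeriv₃
  congr 1
  exact Finset.sum_congr rfl fun k _ => by ring

theorem covDeriv₃_add (hT : ∀ c a b, DifferentiableAt ℝ (T c a b) x)
    (hS : ∀ c a b, DifferentiableAt ℝ (S c a b) x) (d c a b : Fin n) :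
    covDeriv₃ G (fun c a b y => T c a b y + S c a b y) d c a b x
      = covDeriv₃ G T d c a b x + covDeriv₃ G S d c a b x := by
  simp only [covDeriv₃, pderiv_add (hT c a b) (hS c a b), mul_add, Finset.sum_add_distrib]
  ring

theorem covDeriv₃_const_mul (hT : ∀ c a b, DifferentiableAt ℝ (T c a b) x) (r : ℝ)
    (d c a b : Fin n) :
    covDeriv₃ G (fun c a b y => r * T c a b y) d c a b x = r * covDeriv₃ G T d c a b x := by
  simp only [covDeriv₃, pderiv_const_mul (hT c a b), mul_sub, Finset.mul_sum]
  congr 1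
  exact Finset.sum_congr rfl fun k _ => by ring

theorem covDeriv₃_covDerivMatrix (B : Coord n → Matrix (Fin n) (Fin n) ℝ) (d c a b : Fin n) :
    covDeriv₃ G (fun c a b y => covDerivMatrix G B c y a b) d c a b x
      = (pderivMatrix d (covDerivMatrix G B c) x
          - (connectionMatrix G d x)ᵀ * covDerivMatrix G B c x
          - covDerivMatrix G B c x * connectionMatrix G d x) a b
        - ∑ k, christoffel G k d c x * covDerivMatrix G B k x a b := by
  simp only [covDeriv₃, pderivMatrix, connectionMatrix, Matrix.sub_apply, Matrix.mul_apply,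
    Matrix.transpose_apply, Matrix.of_apply, Finset.sum_add_distrib,
    mul_comm (covDerivMatrix G B c x a _)]
  ring

end CovDeriv₃

namespace MetricOn

variable {B : Coord n → Matrix (Fin n) (Fin n) ℝ} (hG : MetricOn G U)

include hG

theorem contDiffOn_christoffel (k i j : Fin n) : ContDiffOn ℝ ∞ (christoffel G k i j) U :=
  have hdG (l i j) : ContDiffOn ℝ ∞ (pderiv l fun y => G y i j) U :=
    contDiffOn_pderiv hG.isOpen (hG.smooth i j) l
  contDiffOn_const.mul (ContDiffOn.sum fun l _ => (hG.smooth.inv hG.det_ne_zero k l).mul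
    (((hdG i l j).add (hdG j l i)).sub (hdG l i j)))

theorem smooth_covDerivMatrix (hB : EntrywiseSmoothOn B U) (c : Fin n) :
    EntrywiseSmoothOn (covDerivMatrix G B c) U :=
  have hΓ : EntrywiseSmoothOn (connectionMatrix G c) U :=
    fun k a => hG.contDiffOn_christoffel k c a
  ((hB.pderivMatrix hG.isOpen c).sub (hΓ.transpose.mul hB)).sub (hB.mul hΓ)

theorem contDiffOn_riemannUp (k l i j : Fin n) : ContDiffOn ℝ ∞ (riemannUp G k l i j) U := by
  have hΓ := hG.contDiffOn_christoffel
  have hdΓ (a k i j) := contDiffOn_pderiv hG.isOpen (hΓ k i j) a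
  exact ((hdΓ i k j l).sub (hdΓ j k i l)).add
    (ContDiffOn.sum fun r _ => ((hΓ k i r).mul (hΓ r j l)).sub ((hΓ k j r).mul (hΓ r i l)))

theorem contDiffOn_weyl (a b c d : Fin n) : ContDiffOn ℝ ∞ (fun y => weyl G y a b c d) U := by
  have hg := hG.smooth
  have hR := hG.contDiffOn_riemannUp
  have hRiem : ContDiffOn ℝ ∞ (riemann G a b c d) U :=
    ContDiffOn.sum fun k _ => (hg a k).mul (hR k b c d)
  have hRic (b d) : ContDiffOn ℝ ∞ (ricci G b d) U := ContDiffOn.sum fun k _ => hR k b k d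
  have hScal : ContDiffOn ℝ ∞ (scalarCurv G) U :=
    ContDiffOn.sum fun b _ => ContDiffOn.sum fun d _ =>
      (hG.smooth.inv hG.det_ne_zero b d).mul (hRic b d)
  exact (hRiem.sub (contDiffOn_const.mul (((((hg a c).mul (hRic b d)).sub
    ((hg a d).mul (hRic b c))).sub ((hg b c).mul (hRic a d))).add
    ((hg b d).mul (hRic a c))))).add ((hScal.div_const _).mul
    (((hg a c).mul (hg b d)).sub ((hg a d).mul (hg b c))))

theorem christoffel_comm (hx : x ∈ U) (k i j : Fin n) :
    christoffel G k i j x = christoffel G k j i x := by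
  have h (l) : pderiv l (fun y => G y i j) x = pderiv l (fun y => G y j i) x :=
    pderiv_congr hG.isOpen (fun y hy => (hG.isSymm y hy).apply j i) hx l
  simp only [christoffel, h]
  congr 1
  exact Finset.sum_congr rfl fun l _ => by ring

theorem sum_mul_christoffel (hx : x ∈ U) (l i j : Fin n) :
    ∑ k, G x l k * christoffel G k i j x = (1 / 2) * (pderiv i (fun y => G y l j) x
      + pderiv j (fun y => G y l i) x - pderiv l (fun y => G y i j) x) := by
  set v : Fin n → ℝ := fun l => (1 / 2) * (pderiv i (fun y => G y l j) x
    + pderiv j (fun y => G y l i) x - pderiv l (fun y => G y i j) x) with hv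
  have hΓ : (fun k => christoffel G k i j x) = (G x)⁻¹ *ᵥ v := by
    ext k
    simp only [christoffel, Matrix.mulVec, dotProduct, Finset.mul_sum, hv]
    exact Finset.sum_congr rfl fun l _ => by ring
  change (G x *ᵥ fun k => christoffel G k i j x) l = v l
  rw [hΓ, Matrix.mulVec_mulVec,
    Matrix.mul_nonsing_inv _ (isUnit_iff_ne_zero.2 (hG.det_ne_zero x hx)), Matrix.one_mulVec]

theorem covDerivMatrix_self (hx : x ∈ U) (c : Fin n) : covDerivMatrix G G c x = 0 := by
  have hsymm := (hG.isSymm x hx).apply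
  have hpsymm (l i j) : pderiv l (fun y => G y i j) x = pderiv l (fun y => G y j i) x :=
    pderiv_congr hG.isOpen (fun y hy => (hG.isSymm y hy).apply j i) hx l
  ext a b
  simp only [covDerivMatrix_apply, covDeriv, hsymm b, mul_comm (christoffel G _ _ _ x),
    hG.sum_mul_christoffel hx, hpsymm c b a, hpsymm a b c, hpsymm b a c, Matrix.zero_apply]
  ring

theorem pderiv_eq_sum_christoffel (hx : x ∈ U) (d c a : Fin n) :
    pderiv d (fun y => G y c a) x = ∑ k, christoffel G k d c x * G x k a
      + ∑ k, christoffel G k d a x * G x c k := by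
  have h := congrFun (congrFun (hG.covDerivMatrix_self hx d) c) a
  rw [covDerivMatrix_apply, covDeriv, Matrix.zero_apply] at h
  linarith

theorem covDeriv₃_mul {K : Fin n → Coord n → ℝ} (hK : ∀ b, DifferentiableAt ℝ (K b) x)
    (hx : x ∈ U) (d c a b : Fin n) :
    covDeriv₃ G (fun c a b y => G y c a * K b y) d c a b x = G x c a * covDeriv₁ G K d b x := by
  simp only [covDeriv₃, covDeriv₁]
  rw [pderiv_mul (hG.smooth.differentiableAt hG.isOpen hx c a) (hK b),
    hG.pderiv_eq_sum_christoffel hx]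
  simp only [Finset.sum_add_distrib, mul_sub, add_mul, Finset.mul_sum, Finset.sum_mul,
    mul_assoc, mul_left_comm (christoffel G _ d b x)]
  ring

/-- The Ricci identity for covariant `2`-tensors. -/
theorem covDeriv₃_covDerivMatrix_sub (hB : EntrywiseSmoothOn B U) (hx : x ∈ U)
    (d c a b : Fin n) :
    covDeriv₃ G (fun c a b y => covDerivMatrix G B c y a b) d c a b x
        - covDeriv₃ G (fun c a b y => covDerivMatrix G B c y a b) c d a b x
      = -((curvatureMatrix G d c x)ᵀ * B x + B x * curvatureMatrix G d c x) a b := by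
  have hU := hG.isOpen
  have hΓ (c) : EntrywiseSmoothOn (connectionMatrix G c) U :=
    fun k a => hG.contDiffOn_christoffel k c a
  have leibniz (i j) : pderivMatrix i (covDerivMatrix G B j) x
      = pderivMatrix i (pderivMatrix j B) x
        - ((pderivMatrix i (connectionMatrix G j) x)ᵀ * B x
          + (connectionMatrix G j x)ᵀ * pderivMatrix i B x)
        - (pderivMatrix i B x * connectionMatrix G j x
          + B x * pderivMatrix i (connectionMatrix G j) x) := by
    have hdB := hB.pderivMatrix hU j
    rw [← pderivMatrix_transpose, ← pderivMatrix_mul (hΓ j).transpose hB hU hx,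
      ← pderivMatrix_mul hB (hΓ j) hU hx,
      ← pderivMatrix_sub hdB ((hΓ j).transpose.mul hB) hU hx,
      ← pderivMatrix_sub (hdB.sub ((hΓ j).transpose.mul hB)) (hB.mul (hΓ j)) hU hx]
    rfl
  simp only [covDeriv₃_covDerivMatrix, hG.christoffel_comm hx _ d c, sub_sub_sub_cancel_right]
  rw [← Matrix.sub_apply, ← Matrix.neg_apply]
  refine congrFun (congrFun ?_ a) b
  rw [leibniz, leibniz, curvatureMatrix_eq, pderivMatrix_comm hB hU hx c d]
  simp only [covDerivMatrix, Matrix.transpose_add, Matrix.transpose_sub, Matrix.transpose_mul]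
  noncomm_ring

theorem transpose_curvatureMatrix_mul (hx : x ∈ U) (c d : Fin n) :
    (curvatureMatrix G c d x)ᵀ * G x = -(G x * curvatureMatrix G c d x) := by
  have hzero (d c a b) :
      covDeriv₃ G (fun c a b y => covDerivMatrix G G c y a b) d c a b x = 0 := by
    rw [covDeriv₃_congr (S := fun _ _ _ _ => 0) hG.isOpen _ hx, covDeriv₃_zero]
    exact fun c a b y hy => by simp only [hG.covDerivMatrix_self hy, Matrix.zero_apply]
  ext a b
  have h := hG.covDeriv₃_covDerivMatrix_sub hG.smooth hx c d a b
  rw [hzero, hzero, sub_zero, Matrix.add_apply] at h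
  rw [Matrix.neg_apply]
  linarith

theorem riemann_antisymm_left (hx : x ∈ U) (a b c d : Fin n) :
    riemann G a b c d x = -riemann G b a c d x := by
  simp only [riemann_eq_mul_curvatureMatrix]
  rw [← Matrix.neg_apply, ← hG.transpose_curvatureMatrix_mul hx,
    ← Matrix.transpose_apply (G x * _), Matrix.transpose_mul, hG.isSymm x hx]

theorem riemann_bianchi (hx : x ∈ U) : SatisfiesBianchi (riemann G · · · · x) := by
  intro a b c d
  have hdΓ (l k i j) :
      pderiv l (christoffel G k i j) x = pderiv l (christoffel G k j i) x :=
    pderiv_congr hG.isOpen (fun y hy => hG.christoffel_comm hy k i j) hx l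
  simp only [riemann, ← Finset.sum_add_distrib, ← mul_add]
  refine Finset.sum_eq_zero fun k _ => mul_eq_zero_of_right _ ?_
  simp only [riemannUp, hdΓ b k c d, hdΓ c k d b, hdΓ d k b c, hG.christoffel_comm hx _ b c,
    hG.christoffel_comm hx _ c d, hG.christoffel_comm hx _ d b, Finset.sum_sub_distrib]
  ring

theorem riemann_pair_symm (hx : x ∈ U) (a b c d : Fin n) :
    riemann G a b c d x = riemann G c d a b x :=
  pair_symm_of_satisfiesBianchi (hG.riemann_antisymm_left hx) riemann_antisymm_right
    (hG.riemann_bianchi hx) a b c d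

theorem neg_formAct_curvatureMatrix {F : Matrix (Fin n) (Fin n) ℝ} (hF : Fᵀ = -F) (hx : x ∈ U)
    (d c a b : Fin n) :
    -formAct (curvatureMatrix G d c x) F a b
      = ∑ e, (((G x)⁻¹ * F) e a * riemann G d c e b x
        + ((G x)⁻¹ * F) e b * riemann G d c a e x) := by
  set A := (G x)⁻¹ * F
  have hGA : G x * A = F :=
    Matrix.mul_nonsing_inv_cancel_left _ _ (isUnit_iff_ne_zero.2 (hG.det_ne_zero x hx))
  have hAG : Aᵀ * G x = -F := by
    rw [← hF, ← hGA, Matrix.transpose_mul (G x) A, hG.isSymm x hx]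
  have matrix_eq : -formAct (curvatureMatrix G d c x) F
      = Aᵀ * (G x * curvatureMatrix G d c x) + (G x * curvatureMatrix G d c x) * A := by
    rw [← Matrix.mul_assoc, hAG, ← neg_eq_iff_eq_neg.2 (hG.transpose_curvatureMatrix_mul hx d c),
      Matrix.neg_mul _ A, Matrix.mul_assoc, hGA, formAct, Matrix.neg_mul]
    abel
  rw [← Matrix.neg_apply, matrix_eq, Matrix.add_apply, Matrix.mul_apply, Matrix.mul_apply,
    ← Finset.sum_add_distrib]
  refine Finset.sum_congr rfl fun e _ => ?_
  rw [Matrix.transpose_apply, ← riemann_eq_mul_curvatureMatrix,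
    ← riemann_eq_mul_curvatureMatrix, hG.riemann_pair_symm hx e b, hG.riemann_pair_symm hx a e]
  ring

theorem tensorAct_riemann_eq_sum (hx : x ∈ U) (A : Matrix (Fin n) (Fin n) ℝ) (d c a b : Fin n) :
    tensorAct A (riemann G · · · · x) d c a b
      = ∑ e, (A e a * riemann G d c e b x + A e b * riemann G d c a e x)
        + ∑ e, (A e d * riemann G a b e c x + A e c * riemann G a b d e x) := by
  rw [tensorAct, ← Finset.sum_add_distrib]
  refine Finset.sum_congr rfl fun e _ => ?_
  rw [hG.riemann_pair_symm hx a b e c, hG.riemann_pair_symm hx a b d e]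
  ring

end MetricOn

end Connection

/-! ### The integrability condition of the conformal Killing-Yano equation -/

section Alternating

variable {ι : Type*}

/-- Total antisymmetry of the components of a covariant `3`-tensor. -/
structure IsAlternating₃ (τ : ι → ι → ι → ℝ) : Prop where
  swap_left : ∀ c a b, τ c a b = -τ a c b
  swap_right : ∀ c a b, τ c a b = -τ c b a

/-- The hypotheses make `Ω` invariant under cyclic permutations of its last three indices, so that
the Bianchi identity reads `3 Ω = 0`. -/
theorem SatisfiesBianchi.eq_zero_of_isAlternating₃ {Ω S : ι → ι → ι → ι → ℝ}
    (hΩ : SatisfiesBianchi Ω) (hS : ∀ d, IsAlternating₃ (S d))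
    (hΩS : ∀ d c a b, Ω d c a b = S d c a b - S c d a b + S a b d c - S b a d c) : Ω = 0 := by
  have left := fun d => (hS d).swap_left
  have right := fun d => (hS d).swap_right
  have cyclic (d c a b : ι) : Ω d a b c = Ω d c a b := by
    rw [hΩS, hΩS]
    linarith [left d c a b, right d a c b, right a d b c, left a d b c, right b c d a,
      left b c a d, right b a c d, right c b d a, left c b d a, right c d b a]
  ext d c a b
  simp only [Pi.zero_apply]
  linarith [hΩ d c a b, cyclic d c a b, cyclic d b c a]

variable [Fintype ι]

theorem sum_sum_eq_zero_of_antisymm {f : ι → ι → ℝ} (hf : ∀ a b, f a b = -f b a) :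
    ∑ a, ∑ b, f a b = 0 := by
  have h : ∑ a, ∑ b, f a b = -∑ a, ∑ b, f a b := by
    conv_lhs => rw [Finset.sum_comm]
    simp only [← Finset.sum_neg_distrib]
    exact Finset.sum_congr rfl fun b _ => Finset.sum_congr rfl fun a _ => hf a b
  linarith

theorem sum_inv_mul_cky [DecidableEq ι] {S : Matrix ι ι ℝ} (hS : S.IsSymm) (hdet : S.det ≠ 0)
    (hι : Fintype.card ι ≠ 1) {τ : ι → ι → ι → ℝ} (hτ : ∀ c a b, τ c a b = -τ a c b)
    (K : ι → ℝ) (b : ι) :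
    ∑ c, ∑ a, S⁻¹ c a *
      (τ c a b + 1 / ((Fintype.card ι : ℝ) - 1) * (S c a * K b - S c b * K a)) = K b := by
  have hn : (Fintype.card ι : ℝ) - 1 ≠ 0 := sub_ne_zero.2 (by exact_mod_cast hι)
  have contract_form : ∑ c, ∑ a, S⁻¹ c a * τ c a b = 0 :=
    sum_sum_eq_zero_of_antisymm fun c a => by rw [hS.inv.apply c a, hτ c a b]; ring
  have contract_swap : ∑ c, ∑ a, S⁻¹ c a * (S c b * K a) = K b := by
    conv_rhs => rw [← Matrix.one_mulVec K,
      ← Matrix.mul_nonsing_inv S (isUnit_iff_ne_zero.2 hdet), ← Matrix.mulVec_mulVec]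
    simp only [Matrix.mulVec, dotProduct, Finset.mul_sum, hS.apply b, mul_left_comm]
  have split : ∑ c, ∑ a, S⁻¹ c a *
        (τ c a b + 1 / ((Fintype.card ι : ℝ) - 1) * (S c a * K b - S c b * K a))
      = ∑ c, ∑ a, S⁻¹ c a * τ c a b + 1 / ((Fintype.card ι : ℝ) - 1)
        * ((∑ c, ∑ a, S⁻¹ c a * S c a) * K b - ∑ c, ∑ a, S⁻¹ c a * (S c b * K a)) := by
    simp only [Finset.mul_sum, Finset.sum_mul, ← Finset.sum_sub_distrib,
      ← Finset.sum_add_distrib]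
    exact Finset.sum_congr rfl fun c _ => Finset.sum_congr rfl fun a _ => by ring
  rw [split, contract_form, sum_inv_mul_self hS hdet, contract_swap]
  field_simp
  ring

end Alternating

section Integrability

variable {n : ℕ} {U : Set (Coord n)} {G Φ : Coord n → Matrix (Fin n) (Fin n) ℝ} {x : Coord n}

theorem covDeriv₃_isAlternating₃ {T : Fin n → Fin n → Fin n → Coord n → ℝ} (hU : IsOpen U)
    (hT : ∀ y ∈ U, IsAlternating₃ (T · · · y)) (hx : x ∈ U) (d : Fin n) :
    IsAlternating₃ (covDeriv₃ G T d · · · x) where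
  swap_left c a b := by
    rw [covDeriv₃_congr hU (fun c a b y hy => (hT y hy).swap_left c a b) hx, covDeriv₃_neg,
      covDeriv₃_swap_left]
  swap_right c a b := by
    rw [covDeriv₃_congr hU (fun c a b y hy => (hT y hy).swap_right c a b) hx, covDeriv₃_neg,
      covDeriv₃_swap_right]

/-- The components, on an open set of coordinates, of a pseudo-Riemannian metric and a conformal
Killing-Yano `2`-form. -/
structure CKYOn (G Φ : Coord n → Matrix (Fin n) (Fin n) ℝ) (U : Set (Coord n)) : Prop
    extends MetricOn G U where
  smooth_form : EntrywiseSmoothOn Φ U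
  alt : ∀ y ∈ U, (Φ y)ᵀ = -Φ y
  cky : ∀ y ∈ U, CKYEquationAt G Φ y

/-- The divergence `K_b = gᶜᵃ ∇_c φ_{ab}` of a `2`-form. -/
def divForm (G Φ : Coord n → Matrix (Fin n) (Fin n) ℝ) (b : Fin n) (y : Coord n) : ℝ :=
  ∑ c, ∑ a, (G y)⁻¹ c a * covDerivMatrix G Φ c y a b

/-- The trace-free part `τ` of `∇φ`, a `3`-form when `φ` is a conformal Killing-Yano tensor. -/
def threeForm (G Φ : Coord n → Matrix (Fin n) (Fin n) ℝ) (c a b : Fin n) (y : Coord n) : ℝ :=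
  covDerivMatrix G Φ c y a b
    - 1 / ((n : ℝ) - 1) * (G y c a * divForm G Φ b y - G y c b * divForm G Φ a y)

namespace CKYOn

variable (h : CKYOn G Φ U)

include h

theorem contDiffOn_divForm (b : Fin n) : ContDiffOn ℝ ∞ (divForm G Φ b) U :=
  ContDiffOn.sum fun c _ => ContDiffOn.sum fun a _ =>
    (h.smooth.inv h.det_ne_zero c a).mul (h.smooth_covDerivMatrix h.smooth_form c a b)

theorem contDiffOn_threeForm (c a b : Fin n) : ContDiffOn ℝ ∞ (threeForm G Φ c a b) U :=
  (h.smooth_covDerivMatrix h.smooth_form c a b).sub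
    (contDiffOn_const.mul (((h.smooth c a).mul (h.contDiffOn_divForm b)).sub
      ((h.smooth c b).mul (h.contDiffOn_divForm a))))

theorem threeForm_isAlternating₃ (hn : n ≠ 1) (hx : x ∈ U) :
    IsAlternating₃ (threeForm G Φ · · · x) := by
  obtain ⟨τ, K, τ_left, τ_right, hτK⟩ := h.cky x hx
  have hK (b) : divForm G Φ b x = K b := by
    have contract := sum_inv_mul_cky (h.isSymm x hx) (h.det_ne_zero x hx)
      (by rwa [Fintype.card_fin]) τ_left K b
    simpa only [divForm, covDerivMatrix_apply, hτK, Fintype.card_fin] using contract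
  have hτ : (threeForm G Φ · · · x) = τ := by
    ext c a b
    rw [threeForm, covDerivMatrix_apply, hτK, hK, hK, add_sub_cancel_right]
  rw [hτ]
  exact ⟨τ_left, τ_right⟩

theorem covDeriv₃_covDerivMatrix_form (hx : x ∈ U) (d c a b : Fin n) :
    covDeriv₃ G (fun c a b y => covDerivMatrix G Φ c y a b) d c a b x
      = covDeriv₃ G (threeForm G Φ) d c a b x + 1 / ((n : ℝ) - 1)
        * (G x c a * covDeriv₁ G (divForm G Φ) d b x
          - G x c b * covDeriv₁ G (divForm G Φ) d a x) := by
  set κ := 1 / ((n : ℝ) - 1)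
  set T : Fin n → Fin n → Fin n → Coord n → ℝ := fun c a b y => G y c a * divForm G Φ b y
  have hK (b) : DifferentiableAt ℝ (divForm G Φ b) x :=
    differentiableAt_of_contDiffOn h.isOpen (h.contDiffOn_divForm b) hx
  have hτ (c a b) : DifferentiableAt ℝ (threeForm G Φ c a b) x :=
    differentiableAt_of_contDiffOn h.isOpen (h.contDiffOn_threeForm c a b) hx
  have hT (c a b) : DifferentiableAt ℝ (T c a b) x :=
    (h.smooth.differentiableAt h.isOpen hx c a).mul (hK b)
  have hT_neg (c a b) : DifferentiableAt ℝ (fun y => -T c b a y) x := (hT c b a).fun_neg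
  have hT_add (c a b) : DifferentiableAt ℝ (fun y => T c a b y + -T c b a y) x :=
    (hT c a b).fun_add (hT_neg c a b)
  have decompose : (fun c a b y => covDerivMatrix G Φ c y a b)
      = fun c a b y => threeForm G Φ c a b y + κ * (T c a b y + -T c b a y) := by
    ext c a b y
    simp only [threeForm, T, κ]
    ring
  have hT_swap (d c a b) : covDeriv₃ G (fun c a b y => T c b a y) d c a b x
      = covDeriv₃ G T d c b a x := covDeriv₃_swap_right d c a b
  rw [decompose, covDeriv₃_add hτ fun c a b => (hT_add c a b).const_mul κ,
    covDeriv₃_const_mul hT_add, covDeriv₃_add hT hT_neg, covDeriv₃_neg, hT_swap,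
    h.covDeriv₃_mul hK hx, h.covDeriv₃_mul hK hx, ← sub_eq_add_neg]

theorem curvature_act_eq (hx : x ∈ U) (d c a b : Fin n) :
    ∑ e, (((G x)⁻¹ * Φ x) e a * riemann G d c e b x
        + ((G x)⁻¹ * Φ x) e b * riemann G d c a e x)
      = covDeriv₃ G (threeForm G Φ) d c a b x - covDeriv₃ G (threeForm G Φ) c d a b x
        + 1 / ((n : ℝ) - 1)
          * (G x c a * covDeriv₁ G (divForm G Φ) d b x
            - G x c b * covDeriv₁ G (divForm G Φ) d a x
            - G x d a * covDeriv₁ G (divForm G Φ) c b x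
            + G x d b * covDeriv₁ G (divForm G Φ) c a x) := by
  have ricci_identity := h.covDeriv₃_covDerivMatrix_sub h.smooth_form hx d c a b
  rw [h.covDeriv₃_covDerivMatrix_form hx, h.covDeriv₃_covDerivMatrix_form hx] at ricci_identity
  rw [← h.neg_formAct_curvatureMatrix (h.alt x hx) hx, formAct, ← ricci_identity]
  ring

theorem exists_tensorAct_riemann_eq_kulkarniNomizu (hn : n ≠ 1) (hx : x ∈ U) :
    ∃ N : Matrix (Fin n) (Fin n) ℝ,
      tensorAct ((G x)⁻¹ * Φ x) (riemann G · · · · x) = kulkarniNomizu (G x) N := by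
  have hsymm := (h.isSymm x hx).apply
  set N : Matrix (Fin n) (Fin n) ℝ := Matrix.of fun a b => -(1 / ((n : ℝ) - 1)
    * (covDeriv₁ G (divForm G Φ) a b x + covDeriv₁ G (divForm G Φ) b a x)) with hN
  have hN_symm : N.IsSymm := by
    ext a b
    simp only [hN, Matrix.transpose_apply, Matrix.of_apply, add_comm]
  refine ⟨N, sub_eq_zero.1 (SatisfiesBianchi.eq_zero_of_isAlternating₃
    (((h.riemann_bianchi hx).tensorAct _).sub (kulkarniNomizu_bianchi (h.isSymm x hx) hN_symm))
    (covDeriv₃_isAlternating₃ (G := G) h.isOpen (fun y hy => h.threeForm_isAlternating₃ hn hy) hx)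
    fun d c a b => ?_)⟩
  rw [Pi.sub_apply, Pi.sub_apply, Pi.sub_apply, Pi.sub_apply, h.tensorAct_riemann_eq_sum hx,
    h.curvature_act_eq hx d c a b, h.curvature_act_eq hx a b d c]
  simp only [kulkarniNomizu, hN, Matrix.of_apply]
  rw [hsymm a c, hsymm b c, hsymm a d, hsymm b d]
  ring

end CKYOn

end Integrability

/-! ### The Weyl tensor -/

section Weyl

variable {n : ℕ} {U : Set (Coord n)} {G Φ : Coord n → Matrix (Fin n) (Fin n) ℝ} {x : Coord n}

/-- The Schouten tensor, for which `C = R - g ∧ schouten`. -/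
def schouten (G : Coord n → Matrix (Fin n) (Fin n) ℝ) (x : Coord n) :
    Matrix (Fin n) (Fin n) ℝ :=
  (1 / ((n : ℝ) - 2)) • (Matrix.of (ricci G · · x)
    - (scalarCurv G x / (2 * ((n : ℝ) - 1))) • G x)

theorem weyl_eq_sub (hn : 3 ≤ n) :
    weyl G x = (riemann G · · · · x) - kulkarniNomizu (G x) (schouten G x) := by
  have hn' : (3 : ℝ) ≤ n := by exact_mod_cast hn
  have hn₁ : (n : ℝ) - 1 ≠ 0 := by linarith
  have hn₂ : (n : ℝ) - 2 ≠ 0 := by linarith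
  ext a b c d
  simp only [weyl, kulkarniNomizu, schouten, Pi.sub_apply, Matrix.smul_apply, Matrix.sub_apply,
    Matrix.of_apply, smul_eq_mul]
  field_simp
  ring

theorem weyl_antisymm_right (a b c d : Fin n) : weyl G x a b c d = -weyl G x a b d c := by
  rw [weyl, weyl, riemann_antisymm_right]
  ring

namespace MetricOn

variable (hG : MetricOn G U)

include hG

theorem weyl_antisymm_left (hx : x ∈ U) (a b c d : Fin n) :
    weyl G x a b c d = -weyl G x b a c d := by
  rw [weyl, weyl, hG.riemann_antisymm_left hx]
  ring

theorem ricciContraction_riemann (hx : x ∈ U) :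
    ricciContraction (G x) (riemann G · · · · x) = Matrix.of (ricci G · · x) := by
  have hinv := (hG.isSymm x hx).inv
  ext b d
  simp only [ricciContraction, Matrix.of_apply, ricci]
  rw [Finset.sum_comm]
  refine Finset.sum_congr rfl fun c _ => ?_
  calc ∑ a, (G x)⁻¹ a c * riemann G a b c d x
      = ((G x)⁻¹ * (G x * curvatureMatrix G c d x)) c b := by
        rw [Matrix.mul_apply]
        exact Finset.sum_congr rfl fun a _ => by rw [hinv.apply, riemann_eq_mul_curvatureMatrix]
    _ = riemannUp G c b c d x := by
        rw [Matrix.nonsing_inv_mul_cancel_left _ _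
          (isUnit_iff_ne_zero.2 (hG.det_ne_zero x hx)), curvatureMatrix, Matrix.of_apply]

theorem ricci_comm (hx : x ∈ U) (b d : Fin n) : ricci G b d x = ricci G d b x := by
  have h := hG.ricciContraction_riemann hx
  rw [← Matrix.of_apply (ricci G · · x) b d, ← Matrix.of_apply (ricci G · · x) d b, ← h]
  simp only [ricciContraction, Matrix.of_apply]
  rw [Finset.sum_comm]
  exact Finset.sum_congr rfl fun c _ => Finset.sum_congr rfl fun a _ => by
    rw [hG.riemann_pair_symm hx a b c d, (hG.isSymm x hx).inv.apply a c]

theorem trace_inv_mul_ricci (hx : x ∈ U) :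
    ((G x)⁻¹ * Matrix.of (ricci G · · x)).trace = scalarCurv G x := by
  simp only [Matrix.trace, Matrix.diag, Matrix.mul_apply, Matrix.of_apply, scalarCurv]
  exact Finset.sum_congr rfl fun b _ => Finset.sum_congr rfl fun d _ => by
    rw [hG.ricci_comm hx d b]

theorem ricciContraction_weyl (hn : 3 ≤ n) (hx : x ∈ U) :
    ricciContraction (G x) (weyl G x) = 0 := by
  have hn' : (3 : ℝ) ≤ n := by exact_mod_cast hn
  have hn₁ : (n : ℝ) - 1 ≠ 0 := by linarith
  have hn₂ : (n : ℝ) - 2 ≠ 0 := by linarith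
  have hdet := hG.det_ne_zero x hx
  have trace_schouten : ((G x)⁻¹ * schouten G x).trace
      = 1 / ((n : ℝ) - 2) * (scalarCurv G x - scalarCurv G x / (2 * ((n : ℝ) - 1)) * n) := by
    rw [schouten, Matrix.mul_smul, Matrix.mul_sub, Matrix.mul_smul,
      Matrix.nonsing_inv_mul _ (isUnit_iff_ne_zero.2 hdet), Matrix.trace_smul, Matrix.trace_sub,
      Matrix.trace_smul, Matrix.trace_one, hG.trace_inv_mul_ricci hx, Fintype.card_fin,
      smul_eq_mul, smul_eq_mul]
  rw [weyl_eq_sub hn, ricciContraction_sub, hG.ricciContraction_riemann hx,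
    ricciContraction_kulkarniNomizu (hG.isSymm x hx) hdet, trace_schouten, Fintype.card_fin]
  ext a b
  simp only [schouten, Matrix.sub_apply, Matrix.add_apply, Matrix.smul_apply, Matrix.zero_apply,
    smul_eq_mul]
  field_simp
  ring

end MetricOn

theorem CKYOn.tensorAct_weyl (h : CKYOn G Φ U) (hn : 3 ≤ n) (hx : x ∈ U) :
    tensorAct ((G x)⁻¹ * Φ x) (weyl G x) = 0 := by
  have hsymm := h.isSymm x hx
  have hdet := h.det_ne_zero x hx
  obtain ⟨N, hN⟩ := h.exists_tensorAct_riemann_eq_kulkarniNomizu (by omega) hx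
  set A := (G x)⁻¹ * Φ x with hA
  have pure_trace :
      tensorAct A (weyl G x) = kulkarniNomizu (G x) (N - formAct A (schouten G x)) := by
    rw [weyl_eq_sub hn, tensorAct_sub, hN, tensorAct_kulkarniNomizu, hA,
      formAct_inv_mul_eq_zero hsymm hdet (h.alt x hx), kulkarniNomizu_zero_left, zero_add,
      kulkarniNomizu_sub]
  have trace_free : ricciContraction (G x) (tensorAct A (weyl G x)) = 0 := by
    rw [hA, ricciContraction_tensorAct hsymm (h.alt x hx), h.ricciContraction_weyl hn hx]
    simp [formAct]
  rw [pure_trace] at trace_free ⊢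
  rw [eq_zero_of_ricciContraction_kulkarniNomizu_eq_zero hsymm hdet
    (by rwa [Fintype.card_fin]) trace_free, kulkarniNomizu_zero_right]

end Weyl

section Multilinear

/-- The complexification of a real square matrix. -/
abbrev complexify {ι : Type*} (A : Matrix ι ι ℝ) : Matrix ι ι ℂ :=
  A.map fun r : ℝ => (r : ℂ)

theorem complexify_mul {ι : Type*} [Fintype ι] (A B : Matrix ι ι ℝ) :
    complexify (A * B) = complexify A * complexify B :=
  Matrix.map_mul (f := Complex.ofRealHom)

theorem complexify_neg {ι : Type*} (A : Matrix ι ι ℝ) : complexify (-A) = -complexify A := by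
  ext; simp

theorem complexify_transpose {ι : Type*} (A : Matrix ι ι ℝ) :
    (complexify A)ᵀ = complexify Aᵀ :=
  rfl

theorem det_complexify {ι : Type*} [Fintype ι] [DecidableEq ι] (A : Matrix ι ι ℝ) :
    (complexify A).det = (A.det : ℂ) :=
  (RingHom.map_det Complex.ofRealHom A).symm

theorem det_complexify_ne_zero {ι : Type*} [Fintype ι] [DecidableEq ι] {A : Matrix ι ι ℝ}
    (hA : A.det ≠ 0) : (complexify A).det ≠ 0 := by
  rw [det_complexify]
  exact_mod_cast hA

theorem complexify_mulVec_star {ι : Type*} [Fintype ι] (A : Matrix ι ι ℝ) (u : ι → ℂ) :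
    complexify A *ᵥ star u = star (complexify A *ᵥ u) := by
  ext
  simp [Matrix.mulVec, dotProduct, Complex.conj_ofReal]

theorem mulVec_complexify_injective {ι : Type*} [Fintype ι] [DecidableEq ι] {A : Matrix ι ι ℝ}
    (hA : A.det ≠ 0) : Function.Injective (complexify A).mulVec :=
  Matrix.mulVec_injective_of_isUnit <|
    (Matrix.isUnit_iff_isUnit_det _).2 (isUnit_iff_ne_zero.2 (det_complexify_ne_zero hA))

variable {n : ℕ}

section Bilin

variable (G : Matrix (Fin n) (Fin n) ℝ) (u v w : Fin n → ℂ)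

theorem bilin_eq_dotProduct : bilin G u v = u ⬝ᵥ complexify G *ᵥ v := by
  simp only [bilin, dotProduct, Matrix.mulVec, Matrix.map_apply, Finset.mul_sum]
  exact Finset.sum_congr rfl fun i _ => Finset.sum_congr rfl fun j _ => by ring

theorem bilin_comm {G : Matrix (Fin n) (Fin n) ℝ} (hG : G.IsSymm) : bilin G u v = bilin G v u := by
  simp only [bilin]
  rw [Finset.sum_comm]
  exact Finset.sum_congr rfl fun i _ => Finset.sum_congr rfl fun j _ => by
    rw [hG.apply i j]; ring

theorem bilin_smul_right (c : ℂ) : bilin G u (c • v) = c * bilin G u v := by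
  simp [bilin_eq_dotProduct, Matrix.mulVec_smul]

theorem bilin_smul_left (c : ℂ) : bilin G (c • u) v = c * bilin G u v := by
  simp [bilin_eq_dotProduct]

theorem bilin_add_right : bilin G u (v + w) = bilin G u v + bilin G u w := by
  simp only [bilin_eq_dotProduct, Matrix.mulVec_add, dotProduct_add]

theorem bilin_add_left : bilin G (u + v) w = bilin G u w + bilin G v w := by
  simp only [bilin_eq_dotProduct, add_dotProduct]

theorem bilin_star : bilin G (star u) (star v) = star (bilin G u v) := by
  simp [bilin, Complex.conj_ofReal]

theorem bilin_sum_left {κ : Type*} [Fintype κ] (x : κ → ℂ) (y : κ → Fin n → ℂ) :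
    bilin G (∑ a, x a • y a) v = ∑ a, x a * bilin G (y a) v := by
  simp [bilin_eq_dotProduct, sum_dotProduct]

theorem bilin_sum_right {κ : Type*} [Fintype κ] (x : κ → ℂ) (y : κ → Fin n → ℂ) :
    bilin G v (∑ a, x a • y a) = ∑ a, x a * bilin G v (y a) := by
  simp [bilin_eq_dotProduct, Matrix.mulVec_sum, Matrix.mulVec_smul, dotProduct_sum]

end Bilin

section Quad

variable (W : Fin n → Fin n → Fin n → Fin n → ℝ) (u v w z : Fin n → ℂ)

/-- The covector `W(·, v, w, z)`, which reduces statements on the first argument of `quad` to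
linear algebra. -/
def quadCovector : Fin n → ℂ := fun i => ∑ j, ∑ k, ∑ l, (W i j k l : ℂ) * v j * w k * z l

theorem quad_eq_dotProduct : quad W u v w z = u ⬝ᵥ quadCovector W v w z := by
  simp only [quad, quadCovector, dotProduct, Finset.mul_sum]
  exact Finset.sum_congr rfl fun i _ => Finset.sum_congr rfl fun j _ =>
    Finset.sum_congr rfl fun k _ => Finset.sum_congr rfl fun l _ => by ring

theorem quadCovector_contract (A : Matrix (Fin n) (Fin n) ℝ) :
    quadCovector (fun a b c d => ∑ e, A e a * W e b c d) v w z
      = quadCovector W v w z ᵥ* complexify A := by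
  ext i
  symm
  simp only [quadCovector, Matrix.vecMul, dotProduct, Matrix.map_apply, Complex.ofReal_sum,
    Complex.ofReal_mul, Finset.sum_mul]
  rw [Finset.sum_comm]
  refine Finset.sum_congr rfl fun j _ => ?_
  rw [Finset.sum_comm]
  refine Finset.sum_congr rfl fun k _ => ?_
  rw [Finset.sum_comm]
  exact Finset.sum_congr rfl fun l _ => Finset.sum_congr rfl fun e _ => by ring

theorem quad_swap_fst : quad W u v w z = quad (fun a b c d => W b a c d) v u w z := by
  simp only [quad]
  rw [Finset.sum_comm]
  exact Finset.sum_congr rfl fun i _ => Finset.sum_congr rfl fun j _ =>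
    Finset.sum_congr rfl fun k _ => Finset.sum_congr rfl fun l _ => by ring

theorem quad_swap_mid : quad W u v w z = quad (fun a b c d => W a c b d) u w v z := by
  simp only [quad]
  refine Finset.sum_congr rfl fun i _ => ?_
  rw [Finset.sum_comm]
  exact Finset.sum_congr rfl fun j _ =>
    Finset.sum_congr rfl fun k _ => Finset.sum_congr rfl fun l _ => by ring

theorem quad_swap_snd : quad W u v w z = quad (fun a b c d => W a b d c) u v z w := by
  simp only [quad]
  refine Finset.sum_congr rfl fun i _ => Finset.sum_congr rfl fun j _ => ?_
  rw [Finset.sum_comm]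
  exact Finset.sum_congr rfl fun k _ => Finset.sum_congr rfl fun l _ => by ring

theorem quad_neg : quad (fun a b c d => -W a b c d) u v w z = -quad W u v w z := by
  simp [quad]

theorem quad_add (R : Fin n → Fin n → Fin n → Fin n → ℝ) :
    quad (fun a b c d => W a b c d + R a b c d) u v w z = quad W u v w z + quad R u v w z := by
  simp only [quad, Complex.ofReal_add, add_mul, Finset.sum_add_distrib]

section Sum

variable {κ : Type*} [Fintype κ] (x : κ → ℂ) (y : κ → Fin n → ℂ)

theorem quad_sum_fst : quad W (∑ a, x a • y a) v w z = ∑ a, x a * quad W (y a) v w z := by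
  simp only [quad_eq_dotProduct, sum_dotProduct, smul_dotProduct, smul_eq_mul]

theorem quad_sum_snd : quad W u (∑ a, x a • y a) w z = ∑ a, x a * quad W u (y a) w z := by
  simp only [fun y => quad_swap_fst W u y w z, quad_sum_fst]

theorem quad_sum_trd : quad W u v (∑ a, x a • y a) z = ∑ a, x a * quad W u v (y a) z := by
  simp only [fun y => quad_swap_mid W u v y z, quad_sum_snd]

theorem quad_sum_fth : quad W u v w (∑ a, x a • y a) = ∑ a, x a * quad W u v w (y a) := by
  simp only [fun y => quad_swap_snd W u v w y, quad_sum_trd]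

end Sum

theorem quad_smul (a b c d : ℂ) :
    quad W (a • u) (b • v) (c • w) (d • z) = a * b * c * d * quad W u v w z := by
  simp only [quad, Finset.mul_sum, Pi.smul_apply, smul_eq_mul]
  exact Finset.sum_congr rfl fun i _ => Finset.sum_congr rfl fun j _ =>
    Finset.sum_congr rfl fun k _ => Finset.sum_congr rfl fun l _ => by ring

section Contract

variable (A : Matrix (Fin n) (Fin n) ℝ)

theorem quad_contract_fst : quad (fun a b c d => ∑ e, A e a * W e b c d) u v w z
    = quad W (complexify A *ᵥ u) v w z := by
  rw [quad_eq_dotProduct, quad_eq_dotProduct, quadCovector_contract, dotProduct_comm,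
    ← Matrix.dotProduct_mulVec, dotProduct_comm]

theorem quad_contract_snd : quad (fun a b c d => ∑ e, A e b * W a e c d) u v w z
    = quad W u (complexify A *ᵥ v) w z := by
  rw [quad_swap_fst, quad_contract_fst (fun a b c d => W b a c d), ← quad_swap_fst W]

theorem quad_contract_trd : quad (fun a b c d => ∑ e, A e c * W a b e d) u v w z
    = quad W u v (complexify A *ᵥ w) z := by
  rw [quad_swap_mid, quad_contract_snd (fun a b c d => W a c b d), ← quad_swap_mid W]

theorem quad_contract_fth : quad (fun a b c d => ∑ e, A e d * W a b c e) u v w z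
    = quad W u v w (complexify A *ᵥ z) := by
  rw [quad_swap_snd, quad_contract_trd (fun a b c d => W a b d c), ← quad_swap_snd W]

theorem quad_tensorAct : quad (tensorAct A W) u v w z
    = quad W (complexify A *ᵥ u) v w z + quad W u (complexify A *ᵥ v) w z
      + quad W u v (complexify A *ᵥ w) z + quad W u v w (complexify A *ᵥ z) := by
  rw [← quad_contract_fst, ← quad_contract_snd, ← quad_contract_trd, ← quad_contract_fth,
    ← quad_add, ← quad_add, ← quad_add]
  congr 1
  funext a b c d
  simp only [tensorAct, Finset.sum_add_distrib]

end Contract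

variable {W}

theorem quad_self_fst (hW : ∀ a b c d, W a b c d = -W b a c d) : quad W u u w z = 0 := by
  rw [← self_eq_neg, ← quad_neg, quad_swap_fst]
  simp only [← hW]

theorem quad_self_snd (hW : ∀ a b c d, W a b c d = -W a b d c) : quad W u v w w = 0 := by
  rw [← self_eq_neg, ← quad_neg, quad_swap_snd]
  simp only [← hW]

end Quad

end Multilinear

/-! ### Eigenvectors of the two-form -/

theorem mem_spectrum_iff_exists_mulVec_eq_smul {K ι : Type*} [Field K] [Fintype ι]
    [DecidableEq ι] {A : Matrix ι ι K} {α : K} :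
    α ∈ spectrum K A ↔ ∃ u, u ≠ 0 ∧ A *ᵥ u = α • u := by
  rw [Matrix.mem_spectrum_iff_isRoot_charpoly, Polynomial.IsRoot, Matrix.eval_charpoly,
    ← Matrix.exists_mulVec_eq_zero_iff]
  simp [Matrix.sub_mulVec, Matrix.scalar_apply, ← Matrix.smul_one_eq_diagonal,
    Matrix.smul_mulVec, sub_eq_zero, eq_comm]

section Eigen

variable {n : ℕ} {G Φ : Matrix (Fin n) (Fin n) ℝ} {α β γ δ : ℂ} {u v w z : Fin n → ℂ}

/-- The (possibly zero) complex vector `u` is an eigenvector of the endomorphism `φᵃ_b` with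
eigenvalue `α`. The index is lowered, so that no inverse of the metric appears. -/
def IsEigen (G Φ : Matrix (Fin n) (Fin n) ℝ) (α : ℂ) (u : Fin n → ℂ) : Prop :=
  complexify Φ *ᵥ u = α • complexify G *ᵥ u

theorem complexify_mul_raise (hdet : G.det ≠ 0) :
    complexify G * complexify (G⁻¹ * Φ) = complexify Φ := by
  rw [← complexify_mul, Matrix.mul_nonsing_inv_cancel_left _ _ (isUnit_iff_ne_zero.2 hdet)]

theorem isEigen_iff_mulVec_raise (hdet : G.det ≠ 0) :
    IsEigen G Φ α u ↔ complexify (G⁻¹ * Φ) *ᵥ u = α • u := by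
  rw [IsEigen, ← complexify_mul_raise hdet, ← Matrix.mulVec_mulVec, ← Matrix.mulVec_smul,
    (mulVec_complexify_injective hdet).eq_iff]

theorem IsEigen.mulVec_raise (hdet : G.det ≠ 0) (hu : IsEigen G Φ α u) :
    complexify (G⁻¹ * Φ) *ᵥ u = α • u :=
  (isEigen_iff_mulVec_raise hdet).1 hu

theorem IsEigen.smul (hu : IsEigen G Φ α u) (c : ℂ) : IsEigen G Φ α (c • u) := by
  rw [IsEigen, Matrix.mulVec_smul, hu, Matrix.mulVec_smul, smul_comm]

theorem IsEigen.star (hu : IsEigen G Φ α u) : IsEigen G Φ (starRingEnd ℂ α) (star u) := by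
  rw [IsEigen, complexify_mulVec_star, complexify_mulVec_star, hu, star_smul, starRingEnd_apply]

theorem mem_eigenvalues_iff_det_eq_zero (hdet : G.det ≠ 0) :
    α ∈ eigenvalues G Φ ↔ (α • complexify G - complexify Φ).det = 0 := by
  have factor : α • complexify G - complexify Φ
      = complexify G * (algebraMap ℂ _ α - complexify (G⁻¹ * Φ)) := by
    rw [mul_sub, complexify_mul_raise hdet, ← Algebra.commutes, ← Algebra.smul_def]
  rw [factor, Matrix.det_mul, mul_eq_zero, or_iff_right (det_complexify_ne_zero hdet),
    eigenvalues, spectrum.mem_iff, Matrix.isUnit_iff_isUnit_det, isUnit_iff_ne_zero, not_not]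

theorem mem_eigenvalues_iff_exists_isEigen (hdet : G.det ≠ 0) :
    α ∈ eigenvalues G Φ ↔ ∃ u, u ≠ 0 ∧ IsEigen G Φ α u := by
  simp only [eigenvalues, mem_spectrum_iff_exists_mulVec_eq_smul, isEigen_iff_mulVec_raise hdet]

theorem neg_mem_eigenvalues (hdet : G.det ≠ 0) (hG : G.IsSymm) (hΦ : Φᵀ = -Φ)
    (hα : α ∈ eigenvalues G Φ) : -α ∈ eigenvalues G Φ := by
  rw [mem_eigenvalues_iff_det_eq_zero hdet] at hα ⊢
  have transpose_eq :
      -α • complexify G - complexify Φ = -(α • complexify G - complexify Φ)ᵀ := by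
    rw [Matrix.transpose_sub, Matrix.transpose_smul, complexify_transpose,
      complexify_transpose, hG, hΦ, complexify_neg, neg_smul]
    abel
  rw [transpose_eq, Matrix.det_neg, Matrix.det_transpose, hα, mul_zero]

theorem IsEigen.bilin_form_left (hG : G.IsSymm) (hΦ : Φᵀ = -Φ) (hu : IsEigen G Φ α u)
    (v : Fin n → ℂ) : u ⬝ᵥ complexify Φ *ᵥ v = -(α * bilin G u v) := by
  have hskew : complexify Φ = -(complexify Φ)ᵀ := by
    rw [complexify_transpose, hΦ, complexify_neg, neg_neg]
  rw [hskew, Matrix.neg_mulVec, dotProduct_neg, Matrix.mulVec_transpose, dotProduct_comm,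
    ← Matrix.dotProduct_mulVec, hu, dotProduct_smul, ← bilin_eq_dotProduct, bilin_comm _ _ hG,
    smul_eq_mul]

theorem IsEigen.bilin_eq_zero (hG : G.IsSymm) (hΦ : Φᵀ = -Φ) (hu : IsEigen G Φ α u)
    (hv : IsEigen G Φ β v) (hαβ : α + β ≠ 0) : bilin G u v = 0 := by
  have hright : u ⬝ᵥ complexify Φ *ᵥ v = β * bilin G u v := by
    rw [hv, dotProduct_smul, bilin_eq_dotProduct, smul_eq_mul]
  have hsum : (α + β) * bilin G u v = 0 := by
    linear_combination -hright + hu.bilin_form_left hG hΦ v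
  exact (mul_eq_zero.1 hsum).resolve_left hαβ

theorem quad_eq_zero_of_isEigen {W : Fin n → Fin n → Fin n → Fin n → ℝ} (hdet : G.det ≠ 0)
    (hW : tensorAct (G⁻¹ * Φ) W = 0) (hu : IsEigen G Φ α u) (hv : IsEigen G Φ β v)
    (hw : IsEigen G Φ γ w) (hz : IsEigen G Φ δ z) (hsum : α + β + γ + δ ≠ 0) :
    quad W u v w z = 0 := by
  have hact := quad_tensorAct W u v w z (G⁻¹ * Φ)
  have hfst := quad_smul W u v w z α 1 1 1
  have hsnd := quad_smul W u v w z 1 β 1 1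
  have htrd := quad_smul W u v w z 1 1 γ 1
  have hfth := quad_smul W u v w z 1 1 1 δ
  simp only [one_smul, one_mul, mul_one] at hfst hsnd htrd hfth
  rw [hW, hu.mulVec_raise hdet, hv.mulVec_raise hdet, hw.mulVec_raise hdet,
    hz.mulVec_raise hdet, hfst, hsnd, htrd, hfth] at hact
  have hzero : (α + β + γ + δ) * quad W u v w z = 0 := by
    simp only [quad, Pi.zero_apply, Complex.ofReal_zero, zero_mul, Finset.sum_const_zero] at hact ⊢
    linear_combination -hact
  exact (mul_eq_zero.1 hzero).resolve_left hsum

end Eigen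

/-! ### Null frames that diagonalise the two-form -/

namespace NullDiagonalFrame

variable {m : ℕ} {G Φ : Matrix (Fin (2 * m)) (Fin (2 * m)) ℝ}

theorem swap_ne_self (a : Fin m ⊕ Fin m) : a.swap ≠ a := by
  cases a <;> simp

/-- The eigenvalue of `φ` on each frame vector. The sign comes from lowering the index: `g` sends
`V_μ` to `θ_μ`, while `φ` sends it to `-λ_μ θ_μ`. -/
def ev (F : NullDiagonalFrame m G Φ) : Fin m ⊕ Fin m → ℂ := Sum.elim (fun μ => -F.eig μ) F.eig

variable (F : NullDiagonalFrame m G Φ)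

theorem ev_swap (a : Fin m ⊕ Fin m) : F.ev a.swap = -F.ev a := by
  cases a <;> simp [ev]

theorem V_ne_zero (a : Fin m ⊕ Fin m) : F.V a ≠ 0 := by
  intro h
  simpa [h] using F.dual a a

include F in
theorem isSymm_metric : G.IsSymm := by
  ext i j
  have h : (G j i : ℂ) = G i j := by
    rw [F.metric_eq, F.metric_eq]
    exact Finset.sum_congr rfl fun μ _ => by ring
  exact_mod_cast h

include F in
theorem transpose_form : Φᵀ = -Φ := by
  ext i j
  have h : (Φ j i : ℂ) = -Φ i j := by
    rw [F.form_eq, F.form_eq, ← Finset.sum_neg_distrib]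
    exact Finset.sum_congr rfl fun μ _ => by ring
  exact_mod_cast h

theorem mulVec_metric (a : Fin m ⊕ Fin m) : complexify G *ᵥ F.V a = F.θ a.swap := by
  ext i
  have expand_row : ∀ j, (G i j : ℂ) * F.V a j
      = ∑ b : Fin m ⊕ Fin m, F.θ b.swap i * (F.θ b j * F.V a j) := by
    intro j
    rw [F.metric_eq, Fintype.sum_sum_type, Finset.sum_mul, ← Finset.sum_add_distrib]
    exact Finset.sum_congr rfl fun μ _ => by simp only [Sum.swap_inl, Sum.swap_inr]; ring
  simp only [Matrix.mulVec, dotProduct, Matrix.map_apply, expand_row]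
  rw [Finset.sum_comm]
  simp [← Finset.mul_sum, F.dual]

theorem isEigen (a : Fin m ⊕ Fin m) : IsEigen G Φ (F.ev a) (F.V a) := by
  rw [IsEigen, mulVec_metric]
  ext i
  have expand_row : ∀ j, (Φ i j : ℂ) * F.V a j
      = ∑ b : Fin m ⊕ Fin m, F.ev b * F.θ b.swap i * (F.θ b j * F.V a j) := by
    intro j
    rw [F.form_eq, Fintype.sum_sum_type, Finset.sum_mul, ← Finset.sum_add_distrib]
    exact Finset.sum_congr rfl fun μ _ => by
      simp only [Sum.swap_inl, Sum.swap_inr, ev, Sum.elim_inl, Sum.elim_inr]; ring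
  simp only [Matrix.mulVec, dotProduct, Matrix.map_apply, expand_row]
  rw [Finset.sum_comm]
  simp [← Finset.mul_sum, F.dual]

theorem bilin_V_right (X : Fin (2 * m) → ℂ) (a : Fin m ⊕ Fin m) :
    bilin G X (F.V a) = F.θ a.swap ⬝ᵥ X := by
  rw [bilin_eq_dotProduct, mulVec_metric, dotProduct_comm]

theorem bilin_V_left (a : Fin m ⊕ Fin m) (X : Fin (2 * m) → ℂ) :
    bilin G (F.V a) X = F.θ a.swap ⬝ᵥ X := by
  rw [bilin_comm _ _ F.isSymm_metric, bilin_V_right]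

theorem bilin_V (a b : Fin m ⊕ Fin m) :
    bilin G (F.V a) (F.V b) = if b.swap = a then 1 else 0 :=
  (F.bilin_V_right _ b).trans (F.dual _ a)

theorem bilin_V_self (a : Fin m ⊕ Fin m) : bilin G (F.V a) (F.V a) = 0 := by
  rw [bilin_V, if_neg (swap_ne_self a)]

theorem eq_sum_dotProduct_smul (X : Fin (2 * m) → ℂ) : X = ∑ a, (F.θ a ⬝ᵥ X) • F.V a := by
  have left_inv : Matrix.of F.θ * (Matrix.of F.V)ᵀ = 1 := by
    ext a b
    rw [Matrix.mul_apply, Matrix.one_apply, ← F.dual a b]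
    rfl
  have right_inv : (Matrix.of F.V)ᵀ * Matrix.of F.θ = 1 :=
    (Matrix.mul_eq_one_comm_of_card_eq _ _ _ (by simp [two_mul])).1 left_inv
  calc X = (Matrix.of F.V)ᵀ *ᵥ (Matrix.of F.θ *ᵥ X) := by
        rw [Matrix.mulVec_mulVec, right_inv, Matrix.one_mulVec]
    _ = _ := by
        ext i
        simp only [Matrix.mulVec, dotProduct, Matrix.transpose_apply, Matrix.of_apply,
          Finset.sum_apply, Pi.smul_apply, smul_eq_mul]
        exact Finset.sum_congr rfl fun a _ => mul_comm _ _

theorem eq_sum_bilin_smul (X : Fin (2 * m) → ℂ) : X = ∑ a, bilin G (F.V a.swap) X • F.V a := by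
  simpa only [bilin_V_left, Sum.swap_swap] using F.eq_sum_dotProduct_smul X

include F in
theorem det_metric_ne_zero : G.det ≠ 0 := by
  intro h
  obtain ⟨X, hX, hGX⟩ := Matrix.exists_mulVec_eq_zero_iff.2
    (show (complexify G).det = 0 by rw [det_complexify, h, Complex.ofReal_zero])
  apply hX
  rw [F.eq_sum_bilin_smul X]
  simp [bilin_eq_dotProduct, hGX]

theorem eigenvalues_eq_range_ev : eigenvalues G Φ = Set.range F.ev := by
  ext α
  rw [mem_eigenvalues_iff_exists_isEigen F.det_metric_ne_zero]
  constructor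
  · rintro ⟨u, hu, hα⟩
    by_contra hrange
    apply hu
    rw [F.eq_sum_bilin_smul u]
    refine Finset.sum_eq_zero fun a _ => ?_
    rw [(F.isEigen a.swap).bilin_eq_zero F.isSymm_metric F.transpose_form hα, zero_smul]
    rw [ev_swap]
    exact fun h => hrange ⟨a, by linear_combination -h⟩
  · rintro ⟨a, rfl⟩
    exact ⟨F.V a, F.V_ne_zero a, F.isEigen a⟩

theorem ev_injective (hd : NondegenerateDistinct G Φ) : Function.Injective F.ev := by
  have hcard : (Finset.univ.image F.ev).card = (Finset.univ : Finset (Fin m ⊕ Fin m)).card := by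
    rw [← Set.ncard_coe_finset, Finset.coe_image, Finset.coe_univ, Set.image_univ,
      ← F.eigenvalues_eq_range_ev, hd.2]
    simp [two_mul]
  exact fun a b h => Finset.injOn_of_card_image_eq hcard (by simp) (by simp) h

section Simple

variable {F} (hF : Function.Injective F.ev) {a b : Fin m ⊕ Fin m}
include hF

theorem ev_add_ne_zero (h : b ≠ a.swap) : F.ev a + F.ev b ≠ 0 := fun h0 =>
  h (hF (by rw [ev_swap]; linear_combination h0))

theorem ev_ne_zero (a : Fin m ⊕ Fin m) : F.ev a ≠ 0 := fun h =>
  ev_add_ne_zero hF (swap_ne_self a).symm (by rw [h, add_zero])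

theorem eq_bilin_smul_V_of_isEigen {u : Fin (2 * m) → ℂ}
    (hu : IsEigen G Φ (F.ev a) u) : u = bilin G (F.V a.swap) u • F.V a := by
  conv_lhs => rw [F.eq_sum_bilin_smul u]
  refine Finset.sum_eq_single a (fun b _ hb => ?_) (by simp)
  rw [(F.isEigen b.swap).bilin_eq_zero F.isSymm_metric F.transpose_form hu, zero_smul]
  rw [add_comm]
  exact ev_add_ne_zero hF ((Function.Involutive.injective Sum.swap_swap).ne hb)

end Simple

/-- `W` is aligned with the frame vector `V_a`: its components `W(V_a, ·, ·, ·)` vanish whenever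
the other arguments are frame vectors orthogonal to `V_a`. -/
def Aligned (W : Fin (2 * m) → Fin (2 * m) → Fin (2 * m) → Fin (2 * m) → ℝ)
    (a : Fin m ⊕ Fin m) : Prop :=
  ∀ b c d, b ≠ a.swap → c ≠ a.swap → d ≠ a.swap → quad W (F.V a) (F.V b) (F.V c) (F.V d) = 0

variable {F} {W : Fin (2 * m) → Fin (2 * m) → Fin (2 * m) → Fin (2 * m) → ℝ}
  {a : Fin m ⊕ Fin m}

theorem Aligned.quad_eq_zero (h : F.Aligned W a) {X Y Z : Fin (2 * m) → ℂ}
    (hX : bilin G (F.V a) X = 0) (hY : bilin G (F.V a) Y = 0) (hZ : bilin G (F.V a) Z = 0) :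
    quad W (F.V a) X Y Z = 0 := by
  rw [F.eq_sum_bilin_smul X, F.eq_sum_bilin_smul Y, F.eq_sum_bilin_smul Z, quad_sum_snd]
  refine Finset.sum_eq_zero fun b _ => ?_
  by_cases hb : b = a.swap
  · rw [hb, Sum.swap_swap, hX, zero_mul]
  refine mul_eq_zero_of_right _ ?_
  rw [quad_sum_trd]
  refine Finset.sum_eq_zero fun c _ => ?_
  by_cases hc : c = a.swap
  · rw [hc, Sum.swap_swap, hY, zero_mul]
  refine mul_eq_zero_of_right _ ?_
  rw [quad_sum_fth]
  refine Finset.sum_eq_zero fun d _ => ?_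
  by_cases hd : d = a.swap
  · rw [hd, Sum.swap_swap, hZ, zero_mul]
  exact mul_eq_zero_of_right _ (h b c d hb hc hd)

theorem Aligned.isWAND (h : F.Aligned W a) : IsWAND G W (F.V a) :=
  ⟨F.V_ne_zero a, F.bilin_V_self a, fun _ _ hX hY => h.quad_eq_zero hX (F.bilin_V_self a) hY⟩

theorem Aligned.noPositiveBoost (h : F.Aligned W a) (hF : Function.Injective F.ev)
    (hW : tensorAct (G⁻¹ * Φ) W = 0) : NoPositiveBoost G W (F.V a) (F.V a.swap) := by
  intro X Y Z hX _ hY _ hZ _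
  refine ⟨h.quad_eq_zero hX (F.bilin_V_self a) hY, ?_, h.quad_eq_zero hX hY hZ⟩
  rw [F.eq_sum_bilin_smul X, quad_sum_fth]
  refine Finset.sum_eq_zero fun b _ => ?_
  by_cases hb : b = a.swap
  · rw [hb, Sum.swap_swap, hX, zero_mul]
  refine mul_eq_zero_of_right _ (quad_eq_zero_of_isEigen F.det_metric_ne_zero hW (F.isEigen a)
    (F.isEigen a.swap) (F.isEigen a) (F.isEigen b) ?_)
  rw [ev_swap, add_neg_cancel, zero_add]
  exact ev_add_ne_zero hF hb

theorem Aligned.isTypeDPair (h : F.Aligned W a) (h' : F.Aligned W a.swap)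
    (hF : Function.Injective F.ev) (hW : tensorAct (G⁻¹ * Φ) W = 0) :
    IsTypeDPair G W (F.V a) (F.V a.swap) := by
  refine ⟨F.bilin_V_self a, F.bilin_V_self _, ?_, h.noPositiveBoost hF hW, ?_⟩
  · rw [bilin_V, if_pos (Sum.swap_swap a)]
  · simpa only [Sum.swap_swap] using h'.noPositiveBoost hF hW

variable (F) in
theorem aligned_of_sum_ne_zero (hW : tensorAct (G⁻¹ * Φ) W = 0)
    (hleft : ∀ a b c d, W a b c d = -W b a c d) (hright : ∀ a b c d, W a b c d = -W a b d c)
    (hsum : ∀ b c d, b ≠ a → b ≠ a.swap → c ≠ a.swap → d ≠ a.swap → c ≠ d →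
      F.ev a + F.ev b + F.ev c + F.ev d ≠ 0) : F.Aligned W a := by
  intro b c d hb hc hd
  by_cases hba : b = a
  · rw [hba, quad_self_fst _ _ _ hleft]
  by_cases hcd : c = d
  · rw [hcd, quad_self_snd _ _ _ hright]
  exact quad_eq_zero_of_isEigen F.det_metric_ne_zero hW (F.isEigen a) (F.isEigen b)
    (F.isEigen c) (F.isEigen d) (hsum b c d hba hb hc hd hcd)

variable (F) in
theorem aligned_of_simpleOnTwoForms (hF : Function.Injective F.ev) (hS : SimpleOnTwoForms G Φ)
    (hW : tensorAct (G⁻¹ * Φ) W = 0) (hleft : ∀ a b c d, W a b c d = -W b a c d)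
    (hright : ∀ a b c d, W a b c d = -W a b d c) : F.Aligned W a := by
  refine F.aligned_of_sum_ne_zero hW hleft hright fun b c d hba hb hc hd hcd hsum => ?_
  have hmem (b) : F.ev b ∈ eigenvalues G Φ := F.eigenvalues_eq_range_ev ▸ Set.mem_range_self b
  have hswap : Function.Injective (Sum.swap : Fin m ⊕ Fin m → _) :=
    Function.Involutive.injective Sum.swap_swap
  have hsum' : F.ev a + F.ev b = F.ev c.swap + F.ev d.swap := by
    rw [ev_swap, ev_swap]
    linear_combination hsum
  rcases hS _ (hmem a) _ (hmem b) _ (hmem c.swap) _ (hmem d.swap) (hF.ne hba.symm)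
    (hF.ne (hswap.ne hcd)) (ev_add_ne_zero hF hb) hsum' with ⟨h, -⟩ | ⟨h, -⟩
  · exact hc (by rw [hF h, Sum.swap_swap])
  · exact hd (by rw [hF h, Sum.swap_swap])

end NullDiagonalFrame

/-! ### Existence of diagonalising null frames -/

section Existence

/-- The lexicographic half-plane `Re α > 0`, or `Re α = 0` and `Im α > 0`; it contains exactly one
of `α` and `-α` for every `α ≠ 0`. -/
def LexPos (α : ℂ) : Prop := 0 < toLex (α.re, α.im)

theorem lexPos_neg {α : ℂ} (hα : α ≠ 0) : LexPos (-α) ↔ ¬LexPos α := by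
  have hne : toLex (α.re, α.im) ≠ 0 := fun h =>
    hα (Complex.ext (congrArg (fun p => (ofLex p).1) h) (congrArg (fun p => (ofLex p).2) h))
  have hneg : toLex ((-α).re, (-α).im) = -toLex (α.re, α.im) := rfl
  rw [LexPos, LexPos, hneg, neg_pos, not_lt, hne.le_iff_lt]

theorem exists_injective_sumElim_neg {m : ℕ} {S : Finset ℂ} (hneg : ∀ α ∈ S, -α ∈ S)
    (h0 : 0 ∉ S) (hcard : S.card = 2 * m) :
    ∃ lam : Fin m → ℂ, (∀ μ, lam μ ∈ S) ∧ Function.Injective (Sum.elim (fun μ => -lam μ) lam) := by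
  classical
  have hne : ∀ {α}, α ∈ S → α ≠ 0 := fun hα h => h0 (h ▸ hα)
  have hcompl : (S.filter fun α => ¬LexPos α).card = (S.filter LexPos).card := by
    refine Finset.card_nbij' Neg.neg Neg.neg ?_ ?_ (fun α _ => neg_neg α) (fun α _ => neg_neg α)
    · intro α hα
      simp only [Finset.coe_filter, Set.mem_ofPred_eq] at hα ⊢
      exact ⟨hneg α hα.1, (lexPos_neg (hne hα.1)).2 hα.2⟩
    · intro α hα
      simp only [Finset.coe_filter, Set.mem_ofPred_eq] at hα ⊢
      exact ⟨hneg α hα.1, fun h => (lexPos_neg (hne hα.1)).1 h hα.2⟩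
  have hhalf : (S.filter LexPos).card = m := by
    have := Finset.card_filter_add_card_filter_not (s := S) LexPos
    omega
  let label := (S.filter LexPos).equivFinOfCardEq hhalf
  have hlabel : ∀ μ, (label.symm μ : ℂ) ∈ S ∧ LexPos (label.symm μ) := fun μ =>
    Finset.mem_filter.1 (label.symm μ).2
  have hinj : Function.Injective fun μ => (label.symm μ : ℂ) :=
    Subtype.val_injective.comp label.symm.injective
  refine ⟨fun μ => label.symm μ, fun μ => (hlabel μ).1, (neg_injective.comp hinj).sumElim hinj ?_⟩
  intro μ ν (h : -(label.symm μ : ℂ) = label.symm ν)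
  exact (lexPos_neg (hne (hlabel μ).1)).1 (h ▸ (hlabel ν).2) (hlabel μ).2

section Eigenbasis

variable {n : ℕ} {G Φ : Matrix (Fin n) (Fin n) ℝ}

theorem zero_notMem_eigenvalues (hdet : G.det ≠ 0) (hΦ : Φ.det ≠ 0) : 0 ∉ eigenvalues G Φ := by
  rw [mem_eigenvalues_iff_det_eq_zero hdet, zero_smul, zero_sub, Matrix.det_neg]
  exact mul_ne_zero (pow_ne_zero _ (neg_ne_zero.2 one_ne_zero)) (det_complexify_ne_zero hΦ)

theorem NondegenerateDistinct.det_metric_ne_zero (hd : NondegenerateDistinct G Φ) (hn : n ≠ 1) :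
    G.det ≠ 0 := by
  intro hdet
  rcases Nat.eq_zero_or_pos n with rfl | hpos
  · simp at hdet
  have : Nonempty (Fin n) := ⟨⟨0, hpos⟩⟩
  have hraise : (G⁻¹ * Φ).map (fun r : ℝ => (r : ℂ)) = 0 := by
    rw [Matrix.nonsing_inv_apply_not_isUnit _ (by simp [hdet]), Matrix.zero_mul]
    ext
    simp
  have hcard := hd.2
  rw [eigenvalues, hraise, spectrum.zero_eq, Set.ncard_singleton] at hcard
  exact hn hcard.symm

theorem eq_zero_of_bilin_eq_zero (hdet : G.det ≠ 0) {u : Fin n → ℂ}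
    (h : ∀ v, bilin G v u = 0) : u = 0 := by
  apply mulVec_complexify_injective hdet
  rw [Matrix.mulVec_zero]
  ext i
  rw [Pi.zero_apply, ← h (Pi.single i 1), bilin_eq_dotProduct, single_one_dotProduct]

variable {κ : Type*} [Fintype κ] {ε : κ → ℂ} {u : κ → Fin n → ℂ}

theorem span_range_eq_top_of_isEigen (hdet : G.det ≠ 0) (hcard : Fintype.card κ = n)
    (hε : Function.Injective ε) (hu : ∀ a, IsEigen G Φ (ε a) (u a)) (hu0 : ∀ a, u a ≠ 0) :
    Submodule.span ℂ (Set.range u) = ⊤ := by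
  have hli : LinearIndependent ℂ u :=
    Module.End.eigenvectors_linearIndependent' (Matrix.toLin' (complexify (G⁻¹ * Φ))) ε hε u
      fun a => ⟨Module.End.mem_eigenspace_iff.2 (by
        rw [Matrix.toLin'_apply, (hu a).mulVec_raise hdet]), hu0 a⟩
  exact hli.span_eq_top_of_card_eq_finrank' (by simp [hcard])

theorem bilin_ne_zero_of_span_eq_top {κ : Type*} [Finite κ] {u : κ → Fin n → ℂ} (hdet : G.det ≠ 0)
    (hspan : Submodule.span ℂ (Set.range u) = ⊤) {a b : κ} (hb : u b ≠ 0)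
    (horth : ∀ c, c ≠ a → bilin G (u c) (u b) = 0) : bilin G (u a) (u b) ≠ 0 := by
  have := Fintype.ofFinite κ
  refine fun h => hb (eq_zero_of_bilin_eq_zero hdet fun v => ?_)
  obtain ⟨x, rfl⟩ := (Submodule.mem_span_range_iff_exists_fun ℂ).1
    (hspan ▸ Submodule.mem_top : v ∈ Submodule.span ℂ (Set.range u))
  rw [bilin_sum_left]
  refine Finset.sum_eq_zero fun c _ => mul_eq_zero_of_right _ ?_
  by_cases hc : c = a
  · rw [hc, h]
  · exact horth c hc

end Eigenbasis

variable {m : ℕ} {G Φ : Matrix (Fin (2 * m)) (Fin (2 * m)) ℝ}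

/-- The diagonalising null frame consisting of suitably normalised eigenvectors of `φ`. -/
def NullDiagonalFrame.ofEigenbasis (lam : Fin m → ℂ) (V : Fin m ⊕ Fin m → Fin (2 * m) → ℂ)
    (hV : ∀ a, IsEigen G Φ (Sum.elim (fun μ => -lam μ) lam a) (V a))
    (hpair : ∀ a b, bilin G (V a) (V b) = if b.swap = a then 1 else 0) :
    NullDiagonalFrame m G Φ :=
  let θ : Fin m ⊕ Fin m → Fin (2 * m) → ℂ := fun a => complexify G *ᵥ V a.swap
  have dual : ∀ a b, ∑ i, θ a i * V b i = if a = b then 1 else 0 := fun a b =>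
    calc ∑ i, θ a i * V b i = bilin G (V b) (V a.swap) := by
          rw [bilin_eq_dotProduct, dotProduct_comm]; rfl
      _ = _ := by rw [hpair, Sum.swap_swap]
  have completeness : (Matrix.of V)ᵀ * Matrix.of θ = 1 := by
    refine (Matrix.mul_eq_one_comm_of_card_eq _ _ _ (by simp [two_mul])).1 ?_
    ext a b
    rw [Matrix.mul_apply, Matrix.one_apply, ← dual a b]
    rfl
  have entry : ∀ (A : Matrix (Fin (2 * m)) (Fin (2 * m)) ℝ) i j,
      (A i j : ℂ) = ∑ a, (complexify A *ᵥ V a) i * θ a j := fun A i j =>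
    calc (A i j : ℂ) = (complexify A * ((Matrix.of V)ᵀ * Matrix.of θ)) i j := by
          rw [completeness, Matrix.mul_one]; rfl
      _ = _ := by rw [← Matrix.mul_assoc, Matrix.mul_apply]; rfl
  { θ, V, dual
    eig := lam
    metric_eq := fun i j => by
      rw [entry, Fintype.sum_sum_type, ← Finset.sum_add_distrib]
      exact Finset.sum_congr rfl fun μ _ => by
        simp only [θ, Sum.swap_inl, Sum.swap_inr]
        ring
    form_eq := fun i j => by
      rw [entry, Fintype.sum_sum_type, ← Finset.sum_add_distrib]
      refine Finset.sum_congr rfl fun μ _ => ?_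
      rw [hV, hV]
      simp only [θ, Sum.swap_inl, Sum.swap_inr, Sum.elim_inl, Sum.elim_inr, Pi.smul_apply,
        smul_eq_mul]
      ring }

theorem exists_smul_bilin_eq_ite (hG : G.IsSymm) {u : Fin m ⊕ Fin m → Fin (2 * m) → ℂ}
    (horth : ∀ a b, b.swap ≠ a → bilin G (u a) (u b) = 0)
    (hpair : ∀ a, bilin G (u a) (u a.swap) ≠ 0) :
    ∃ s : Fin m ⊕ Fin m → ℂ,
      ∀ a b, bilin G (s a • u a) (s b • u b) = if b.swap = a then 1 else 0 := by
  refine ⟨Sum.elim (fun _ => 1) fun μ => (bilin G (u (Sum.inl μ)) (u (Sum.inr μ)))⁻¹,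
    fun a b => ?_⟩
  rw [bilin_smul_left, bilin_smul_right]
  by_cases h : b.swap = a
  · rw [if_pos h, ← h]
    rcases b with μ | μ
    · simpa [bilin_comm _ _ hG] using inv_mul_cancel₀ (hpair (Sum.inl μ))
    · simpa using inv_mul_cancel₀ (hpair (Sum.inl μ))
  · rw [if_neg h, horth a b h, mul_zero, mul_zero]

theorem nonempty_nullDiagonalFrame (hG : G.IsSymm) (hΦ : Φᵀ = -Φ)
    (hd : NondegenerateDistinct G Φ) : Nonempty (NullDiagonalFrame m G Φ) := by
  have hdet : G.det ≠ 0 := hd.det_metric_ne_zero (by omega)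
  have hfin : (eigenvalues G Φ).Finite := Matrix.finite_spectrum _
  have hneg : ∀ α ∈ eigenvalues G Φ, -α ∈ eigenvalues G Φ := fun α =>
    neg_mem_eigenvalues hdet hG hΦ
  obtain ⟨lam, hlam, hinj⟩ := exists_injective_sumElim_neg (S := hfin.toFinset) (m := m)
    (by simpa using hneg) (by simpa using zero_notMem_eigenvalues hdet hd.1)
    (by rw [← Set.ncard_eq_toFinset_card _ hfin, hd.2])
  simp only [Set.Finite.mem_toFinset] at hlam
  set ε := Sum.elim (fun μ => -lam μ) lam
  have hε : ∀ a, ε a ∈ eigenvalues G Φ := by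
    rintro (μ | μ)
    exacts [hneg _ (hlam μ), hlam μ]
  choose u hu0 hu using fun a => (mem_eigenvalues_iff_exists_isEigen hdet).1 (hε a)
  have horth : ∀ a b, b.swap ≠ a → bilin G (u a) (u b) = 0 := fun a b hb =>
    (hu a).bilin_eq_zero hG hΦ (hu b) fun h => hb (hinj (by
      rw [show ε b.swap = -ε b by cases b <;> simp [ε]]; linear_combination -h))
  have hspan := span_range_eq_top_of_isEigen hdet (by simp [two_mul]) hinj hu hu0
  have hpair : ∀ a, bilin G (u a) (u a.swap) ≠ 0 := fun a =>
    bilin_ne_zero_of_span_eq_top hdet hspan (hu0 _) fun c hc =>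
      horth c _ (by rw [Sum.swap_swap]; exact hc.symm)
  obtain ⟨s, hs⟩ := exists_smul_bilin_eq_ite hG horth hpair
  exact ⟨.ofEigenbasis lam (fun a => s a • u a) (fun a => (hu a).smul _) hs⟩

end Existence

/-! ### Lorentzian signature -/

section Hermitian

variable {n : ℕ} {G : Matrix (Fin n) (Fin n) ℝ} {u w : Fin n → ℂ}

/-- The hermitian extension `g(u, ū)` of the metric, which is real for symmetric `G`. -/
def hermSq (G : Matrix (Fin n) (Fin n) ℝ) (u : Fin n → ℂ) : ℝ := (bilin G u (star u)).re

theorem hermSq_star (hG : G.IsSymm) (u : Fin n → ℂ) : hermSq G (star u) = hermSq G u := by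
  rw [hermSq, star_star, bilin_comm _ _ hG, hermSq]

theorem bilin_smul_star_smul (c : ℂ) (u : Fin n → ℂ) :
    bilin G (c • u) (star (c • u)) = (‖c‖ ^ 2 : ℝ) * bilin G u (star u) := by
  rw [star_smul, bilin_smul_left, bilin_smul_right, ← mul_assoc, Complex.star_def,
    Complex.mul_conj', Complex.ofReal_pow]

theorem hermSq_smul (c : ℂ) (u : Fin n → ℂ) : hermSq G (c • u) = ‖c‖ ^ 2 * hermSq G u := by
  rw [hermSq, bilin_smul_star_smul, Complex.re_ofReal_mul, hermSq]

theorem hermSq_add_of_orthogonal (hG : G.IsSymm) (huw : bilin G u (star w) = 0) :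
    hermSq G (u + w) = hermSq G u + hermSq G w := by
  have hwu : bilin G w (star u) = 0 := by
    rw [bilin_comm _ _ hG, ← star_star w, bilin_star, huw, star_zero]
  simp only [hermSq, star_add, bilin_add_left, bilin_add_right, huw, hwu, add_zero, zero_add,
    Complex.add_re]

theorem hermSq_sum_of_orthogonal {κ : Type*} [Fintype κ] (x : κ → ℂ) {y : κ → Fin n → ℂ}
    (hy : ∀ a b, b ≠ a → bilin G (y a) (star (y b)) = 0) :
    hermSq G (∑ a, x a • y a) = ∑ a, ‖x a‖ ^ 2 * hermSq G (y a) := by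
  have hdiag : bilin G (∑ a, x a • y a) (star (∑ a, x a • y a))
      = ∑ a, bilin G (x a • y a) (star (x a • y a)) := by
    simp only [star_sum, star_smul, bilin_sum_left, bilin_sum_right, bilin_smul_left,
      bilin_smul_right]
    refine Finset.sum_congr rfl fun a _ => congrArg _ (Finset.sum_eq_single a ?_ (by simp))
    exact fun b _ hb => by rw [hy b a hb.symm, mul_zero]
  rw [hermSq, hdiag, Complex.re_sum]
  exact Finset.sum_congr rfl fun a _ => hermSq_smul (x a) (y a)

theorem bilin_mulVec_mulVec (P : Matrix (Fin n) (Fin n) ℝ) (u v : Fin n → ℂ) :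
    bilin G (complexify P *ᵥ u) (complexify P *ᵥ v) = bilin (Pᵀ * G * P) u v := by
  rw [bilin_eq_dotProduct, bilin_eq_dotProduct, complexify_mul, complexify_mul,
    ← complexify_transpose, ← Matrix.vecMul_transpose, ← Matrix.dotProduct_mulVec,
    Matrix.mulVec_mulVec, Matrix.mulVec_mulVec]

theorem hermSq_smul_diagonal (s : ℝ) (d : Fin n → ℝ) (y : Fin n → ℂ) :
    hermSq (s • Matrix.diagonal d) y = s * ∑ i, d i * ‖y i‖ ^ 2 := by
  have hterm : ∀ i, ∑ j, (((s • Matrix.diagonal d) i j : ℝ) : ℂ) * y i * star y j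
      = (s * (d i * ‖y i‖ ^ 2) : ℝ) := by
    intro i
    rw [Finset.sum_eq_single i (fun j _ hj => by simp [Matrix.diagonal_apply_ne' d hj]) (by simp),
      mul_assoc, Pi.star_apply, Complex.star_def, Complex.mul_conj']
    simp [mul_assoc]
  rw [hermSq, bilin, Finset.sum_congr rfl fun i _ => hterm i, ← Complex.ofReal_sum,
    Complex.ofReal_re, Finset.mul_sum]

/-- `T` is a time coordinate of a metric of sign `s`: on its kernel `s • g` is negative definite. -/
def IsTimeCoordinate (G : Matrix (Fin n) (Fin n) ℝ) (s : ℝ) (T : (Fin n → ℂ) →ₗ[ℂ] ℂ) : Prop :=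
  ∀ u, T u = 0 → u ≠ 0 → s * hermSq G u < 0

theorem IsLorentzian.exists_isTimeCoordinate (hL : IsLorentzian G) (hn : 0 < n) :
    ∃ (s : ℝ) (T : (Fin n → ℂ) →ₗ[ℂ] ℂ), IsTimeCoordinate G s T ∧ ∃ u, 0 < s * hermSq G u := by
  obtain ⟨s, P, hs, hP, hPG⟩ := hL
  have hs2 : s * s = 1 := by rcases hs with rfl | rfl <;> norm_num
  set i₀ : Fin n := ⟨0, hn⟩
  set d : Fin n → ℝ := fun i => if i.val = 0 then 1 else -1 with hd
  have hval : ∀ y, s * hermSq G (complexify P *ᵥ y) = ∑ i, d i * ‖y i‖ ^ 2 := by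
    intro y
    rw [hermSq, ← complexify_mulVec_star, bilin_mulVec_mulVec, hPG, ← hermSq,
      hermSq_smul_diagonal, ← mul_assoc, hs2, one_mul]
  have hP_inv : ∀ u, complexify P *ᵥ (complexify P⁻¹ *ᵥ u) = u := fun u => by
    rw [Matrix.mulVec_mulVec, ← complexify_mul, Matrix.mul_nonsing_inv _ (isUnit_iff_ne_zero.2 hP),
      complexify, Matrix.map_one _ Complex.ofReal_zero Complex.ofReal_one, Matrix.one_mulVec]
  refine ⟨s, (LinearMap.proj i₀).comp (complexify P⁻¹).mulVecLin, fun u hTu hu => ?_,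
    complexify P *ᵥ Pi.single i₀ 1, ?_⟩
  · set y := complexify P⁻¹ *ᵥ u with hy
    have hy₀ : y i₀ = 0 := hTu
    have hspace : ∀ i, d i * ‖y i‖ ^ 2 = -‖y i‖ ^ 2 := by
      intro i
      by_cases hi : i = i₀
      · simp [hi, hy₀]
      · simp [hd, show i.val ≠ 0 from fun h => hi (Fin.ext h)]
    obtain ⟨i, hi⟩ : ∃ i, y i ≠ 0 := by
      by_contra! h
      exact hu (by rw [← hP_inv u, ← hy, show y = 0 from funext h, Matrix.mulVec_zero])
    rw [← hP_inv u, ← hy, hval]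
    simp only [hspace]
    exact Finset.sum_neg' (fun j _ => neg_nonpos.2 (sq_nonneg _))
      ⟨i, Finset.mem_univ i, neg_neg_of_pos (pow_pos (norm_pos_iff.2 hi) 2)⟩
  · rw [hval, Finset.sum_eq_single i₀ (fun j _ hj => by simp [Pi.single_eq_of_ne hj]) (by simp)]
    simp [hd, i₀]

theorem IsTimeCoordinate.exists_eq_smul {s : ℝ} {T : (Fin n → ℂ) →ₗ[ℂ] ℂ}
    (hT : IsTimeCoordinate G s T) (hG : G.IsSymm) (hu0 : u ≠ 0) (hu : 0 ≤ s * hermSq G u)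
    (hw : 0 ≤ s * hermSq G w) (huw : bilin G u (star w) = 0) : ∃ c : ℂ, w = c • u := by
  have hTu : T u ≠ 0 := fun h => (hT u h hu0).not_ge hu
  have hcomb : w - (T w / T u) • u = 0 := by
    by_contra hne
    refine (hT _ (by simp [hTu]) hne).not_ge ?_
    rw [sub_eq_neg_add, ← neg_smul, hermSq_add_of_orthogonal hG, hermSq_smul]
    · nlinarith [mul_nonneg (sq_nonneg ‖-(T w / T u)‖) hu]
    · rw [bilin_smul_left, huw, mul_zero]
  exact ⟨_, sub_eq_zero.1 hcomb⟩

theorem IsLorentzian.exists_eq_smul_of_null (hL : IsLorentzian G) (hG : G.IsSymm) (hu0 : u ≠ 0)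
    (hu : bilin G u (star u) = 0) (hw : bilin G w (star w) = 0)
    (huw : bilin G u (star w) = 0) : ∃ c : ℂ, w = c • u := by
  obtain ⟨i, -⟩ := Function.ne_iff.1 hu0
  obtain ⟨s, T, hT, -⟩ := hL.exists_isTimeCoordinate i.pos
  refine hT.exists_eq_smul hG hu0 ?_ ?_ huw
  · simp [hermSq, hu]
  · simp [hermSq, hw]

end Hermitian

section RealDirection

variable {n : ℕ} {v : Fin n → ℂ}

theorem star_toComplex (l : Fin n → ℝ) : star (toComplex l) = toComplex l := by
  ext
  simp [toComplex]

theorem toComplex_ne_zero {l : Fin n → ℝ} (hl : l ≠ 0) : toComplex l ≠ 0 := fun h =>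
  hl (funext fun i => Complex.ofReal_injective (congrFun h i))

theorem bilin_toComplex (G : Matrix (Fin n) (Fin n) ℝ) (l k : Fin n → ℝ) :
    bilin G (toComplex l) (toComplex k) = (l ⬝ᵥ G *ᵥ k : ℝ) := by
  simp only [bilin, toComplex, dotProduct, Matrix.mulVec, Finset.mul_sum]
  push_cast
  exact Finset.sum_congr rfl fun i _ => Finset.sum_congr rfl fun j _ => by ring

theorem isRealDirection_of_star_smul_eq {t : ℂ} (ht : t ≠ 0) (hv : v ≠ 0)
    (h : star (t • v) = t • v) : IsRealDirection v := by
  have hreal : t • v = toComplex fun i => (t * v i).re :=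
    funext fun i => (Complex.conj_eq_iff_re.1 (congrFun h i)).symm
  refine ⟨t⁻¹, fun i => (t * v i).re, inv_ne_zero ht, fun h0 => ?_, ?_⟩
  · rw [h0] at hreal
    exact smul_ne_zero ht hv (hreal.trans (funext fun _ => Complex.ofReal_zero))
  · rw [← hreal, inv_smul_smul₀ ht]

theorem isRealDirection_of_star_eq_smul {c : ℂ} (hv : v ≠ 0) (h : star v = c • v) :
    IsRealDirection v := by
  by_cases hc : 1 + c = 0
  · refine isRealDirection_of_star_smul_eq Complex.I_ne_zero hv ?_
    rw [star_smul, h, eq_neg_of_add_eq_zero_right hc]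
    simp
  · refine isRealDirection_of_star_smul_eq hc hv ?_
    rw [add_smul, one_smul, ← h, star_add, star_star, add_comm]

end RealDirection

section TypeD

variable {n : ℕ} {G : Matrix (Fin n) (Fin n) ℝ} {W : Fin n → Fin n → Fin n → Fin n → ℝ}
  {u v : Fin n → ℂ}

theorem NoPositiveBoost.smul_smul (h : NoPositiveBoost G W u v) {c d : ℂ} (hc : c ≠ 0)
    (hd : d ≠ 0) : NoPositiveBoost G W (c • u) (d • v) := by
  intro X Y Z hX hX' hY hY' hZ hZ'
  simp only [bilin_smul_left, mul_eq_zero, hc, hd, false_or] at hX hX' hY hY' hZ hZ'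
  obtain ⟨hweight₂, hweight₁, hweight₁'⟩ := h X Y Z hX hX' hY hY' hZ hZ'
  have h₂ := quad_smul W u X u Y c 1 c 1
  have h₁ := quad_smul W u v u X c d c 1
  have h₁' := quad_smul W u X Y Z c 1 1 1
  simp only [one_smul, hweight₂, hweight₁, hweight₁', mul_zero] at h₂ h₁ h₁'
  exact ⟨h₂, h₁, h₁'⟩

theorem IsTypeDPair.smul_inv_smul (h : IsTypeDPair G W u v) {c : ℂ} (hc : c ≠ 0) :
    IsTypeDPair G W (c • u) (c⁻¹ • v) := by
  obtain ⟨hu, hv, huv, hboost, hboost'⟩ := h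
  refine ⟨?_, ?_, ?_, hboost.smul_smul hc (inv_ne_zero hc),
    hboost'.smul_smul (inv_ne_zero hc) hc⟩
  · rw [bilin_smul_left, bilin_smul_right, hu, mul_zero, mul_zero]
  · rw [bilin_smul_left, bilin_smul_right, hv, mul_zero, mul_zero]
  · rw [bilin_smul_left, bilin_smul_right, huv, mul_one, mul_inv_cancel₀ hc]

theorem IsTypeDPair.isTypeD (h : IsTypeDPair G W u v) (hW : W ≠ 0) (hu : IsRealDirection u)
    (hv : IsRealDirection v) : IsTypeD G W := by
  obtain ⟨c, l, hc, -, rfl⟩ := hu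
  obtain ⟨d, k, -, -, rfl⟩ := hv
  have hpair := h.2.2.1
  rw [bilin_smul_left, bilin_smul_right, bilin_toComplex, ← mul_assoc] at hpair
  have hcd : c * d = ((l ⬝ᵥ G *ᵥ k)⁻¹ : ℝ) := by
    rw [Complex.ofReal_inv]
    exact eq_inv_of_mul_eq_one_left hpair
  refine ⟨hW, l, (l ⬝ᵥ G *ᵥ k)⁻¹ • k, ?_⟩
  have hrescaled := h.smul_inv_smul (inv_ne_zero hc)
  rw [inv_smul_smul₀ hc, inv_inv, smul_smul, hcd] at hrescaled
  convert hrescaled using 1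
  ext
  simp [toComplex]

end TypeD

namespace NullDiagonalFrame

variable {m : ℕ} {G Φ : Matrix (Fin (2 * m)) (Fin (2 * m)) ℝ} (F : NullDiagonalFrame m G Φ)
  {a b : Fin m ⊕ Fin m}

theorem re_ev_swap (a : Fin m ⊕ Fin m) : (F.ev a.swap).re = -(F.ev a).re := by
  rw [F.ev_swap, Complex.neg_re]

theorem bilin_V_star_self (ha : (F.ev a).re ≠ 0) : bilin G (F.V a) (star (F.V a)) = 0 := by
  refine (F.isEigen a).bilin_eq_zero F.isSymm_metric F.transpose_form (F.isEigen a).star ?_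
  rw [Complex.add_conj]
  exact_mod_cast mul_ne_zero two_ne_zero ha

theorem star_V_eq_smul (hL : IsLorentzian G) (ha : (F.ev a).re ≠ 0) :
    ∃ c : ℂ, star (F.V a) = c • F.V a := by
  have hnull := F.bilin_V_star_self ha
  refine hL.exists_eq_smul_of_null F.isSymm_metric (F.V_ne_zero a) hnull ?_ ?_
  · rw [star_star, bilin_comm _ _ F.isSymm_metric, hnull]
  · rw [star_star, F.bilin_V_self]

theorem isRealDirection_V (hL : IsLorentzian G) (ha : (F.ev a).re ≠ 0) :
    IsRealDirection (F.V a) :=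
  let ⟨_, hc⟩ := F.star_V_eq_smul hL ha
  isRealDirection_of_star_eq_smul (F.V_ne_zero a) hc

theorem re_ev_ne_zero_of_isRealDirection (hF : Function.Injective F.ev)
    (h : IsRealDirection (F.V a)) : (F.ev a).re ≠ 0 := by
  obtain ⟨c, l, hc, hl, hV⟩ := h
  have heigen : IsEigen G Φ (F.ev a) (toComplex l) := by
    simpa only [hV, inv_smul_smul₀ hc] using (F.isEigen a).smul c⁻¹
  have heigen_conj : IsEigen G Φ (starRingEnd ℂ (F.ev a)) (toComplex l) := by
    simpa only [star_toComplex] using heigen.star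
  have hreal : starRingEnd ℂ (F.ev a) = F.ev a := by
    refine smul_left_injective ℂ (toComplex_ne_zero hl) ?_
    change starRingEnd ℂ (F.ev a) • toComplex l = F.ev a • toComplex l
    rw [← heigen_conj.mulVec_raise F.det_metric_ne_zero, heigen.mulVec_raise F.det_metric_ne_zero]
  intro h0
  apply ev_ne_zero hF a
  rw [← Complex.conj_eq_iff_re.1 hreal, h0, Complex.ofReal_zero]

/-- Otherwise `V_a` and `V_b` would be real, null and orthogonal, hence proportional. -/
theorem re_ev_eq_zero_of_ne (hL : IsLorentzian G) (ha : (F.ev a).re ≠ 0) (hb : b ≠ a)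
    (hb' : b ≠ a.swap) : (F.ev b).re = 0 := by
  by_contra hre
  obtain ⟨c, hc⟩ := F.star_V_eq_smul hL hre
  have horth : bilin G (F.V a) (F.V b) = 0 := by
    rw [bilin_V, if_neg fun h => hb' (by rw [← h, Sum.swap_swap])]
  obtain ⟨d, hd⟩ := hL.exists_eq_smul_of_null F.isSymm_metric (F.V_ne_zero a)
    (F.bilin_V_star_self ha) (F.bilin_V_star_self hre)
    (by rw [hc, bilin_smul_right, horth, mul_zero])
  have hpair : bilin G (F.V b.swap) (F.V b) = 1 := by rw [bilin_V, if_pos rfl]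
  rw [hd, bilin_smul_right, bilin_V, if_neg, mul_zero] at hpair
  · exact zero_ne_one hpair
  · exact (Function.Involutive.injective Sum.swap_swap).ne hb.symm

/-- If all eigenvalues were imaginary, the frame would be orthogonal for the hermitian form and so
would contain a timelike vector, orthogonal to its conjugate, which is timelike too. -/
theorem exists_re_ev_ne_zero (hF : Function.Injective F.ev) (hL : IsLorentzian G) (hm : 0 < m) :
    ∃ a, (F.ev a).re ≠ 0 := by
  by_contra! hre
  have hG := F.isSymm_metric
  obtain ⟨s, T, hT, u, hu⟩ := hL.exists_isTimeCoordinate (by omega)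
  have horth : ∀ a b, b ≠ a → bilin G (F.V a) (star (F.V b)) = 0 := by
    intro a b hb
    refine (F.isEigen a).bilin_eq_zero hG F.transpose_form (F.isEigen b).star ?_
    have himag : starRingEnd ℂ (F.ev b) = -F.ev b := Complex.ext (by simp [hre b]) (by simp)
    rw [himag, ← F.ev_swap]
    exact ev_add_ne_zero hF ((Function.Involutive.injective Sum.swap_swap).ne hb)
  obtain ⟨a, ha⟩ : ∃ a, 0 < s * hermSq G (F.V a) := by
    by_contra! hspace
    rw [F.eq_sum_bilin_smul u, hermSq_sum_of_orthogonal _ horth, Finset.mul_sum] at hu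
    refine hu.not_ge (Finset.sum_nonpos fun a _ => ?_)
    rw [mul_left_comm]
    exact mul_nonpos_of_nonneg_of_nonpos (sq_nonneg _) (hspace a)
  obtain ⟨c, hc⟩ := hT.exists_eq_smul hG (F.V_ne_zero a) (w := star (F.V a)) ha.le
    (by rw [hermSq_star hG]; exact ha.le) (by rw [star_star, F.bilin_V_self])
  rw [hermSq, hc, bilin_smul_right, F.bilin_V_self, mul_zero, Complex.zero_re, mul_zero] at ha
  exact ha.false

variable {W : Fin (2 * m) → Fin (2 * m) → Fin (2 * m) → Fin (2 * m) → ℝ}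

theorem aligned_of_re_ev_ne_zero (hL : IsLorentzian G) (hW : tensorAct (G⁻¹ * Φ) W = 0)
    (hleft : ∀ a b c d, W a b c d = -W b a c d) (hright : ∀ a b c d, W a b c d = -W a b d c)
    (ha : (F.ev a).re ≠ 0) : F.Aligned W a := by
  refine F.aligned_of_sum_ne_zero hW hleft hright fun b c d hba hb hc hd hcd hsum => ha ?_
  have himag : ∀ e, e ≠ a → e ≠ a.swap → (F.ev e).re = 0 := fun _ => F.re_ev_eq_zero_of_ne hL ha
  have hre := congrArg Complex.re hsum
  simp only [Complex.add_re, Complex.zero_re, himag b hba hb] at hre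
  by_cases hca : c = a
  · rw [hca, himag d (fun h => hcd (hca.trans h.symm)) hd] at hre
    linarith
  · rw [himag c hca hc] at hre
    by_cases hda : d = a
    · rw [hda] at hre
      linarith
    · rw [himag d hda hd] at hre
      linarith

theorem exists_isRealDirection_isTypeDPair (hF : Function.Injective F.ev) (hL : IsLorentzian G)
    (hm : 0 < m) (hW : tensorAct (G⁻¹ * Φ) W = 0)
    (hleft : ∀ a b c d, W a b c d = -W b a c d) (hright : ∀ a b c d, W a b c d = -W a b d c) :
    ∃ μ, IsRealDirection (F.V (Sum.inl μ)) ∧ IsRealDirection (F.V (Sum.inr μ)) ∧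
      IsTypeDPair G W (F.V (Sum.inl μ)) (F.V (Sum.inr μ)) := by
  obtain ⟨a, ha⟩ := F.exists_re_ev_ne_zero hF hL hm
  have ha' : (F.ev a.swap).re ≠ 0 := by rwa [re_ev_swap, neg_ne_zero]
  obtain ⟨μ, hμ, hμ'⟩ :
      ∃ μ, (F.ev (Sum.inl μ)).re ≠ 0 ∧ (F.ev (Sum.inr μ)).re ≠ 0 := by
    rcases a with μ | μ
    exacts [⟨μ, ha, ha'⟩, ⟨μ, ha', ha⟩]
  have haligned {b} (hb : (F.ev b).re ≠ 0) : F.Aligned W b :=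
    F.aligned_of_re_ev_ne_zero hL hW hleft hright hb
  exact ⟨μ, F.isRealDirection_V hL hμ, F.isRealDirection_V hL hμ',
    (haligned hμ).isTypeDPair (haligned hμ') hF hW⟩

end NullDiagonalFrame

/-! ### Passage to the limit -/

section Spectrum

variable {ι κ X R : Type*} [Fintype ι]

theorem tendsto_mulVec [NonUnitalNonAssocSemiring R] [TopologicalSpace R] [ContinuousAdd R]
    [ContinuousMul R] {l : Filter X} {A : X → Matrix κ ι R} {A₀ : Matrix κ ι R} {u : X → ι → R}
    {u₀ : ι → R} (hA : Tendsto A l (𝓝 A₀)) (hu : Tendsto u l (𝓝 u₀)) :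
    Tendsto (fun y => A y *ᵥ u y) l (𝓝 (A₀ *ᵥ u₀)) :=
  tendsto_pi_nhds.2 fun i => tendsto_finsetSum _ fun j _ =>
    (((continuous_id.matrix_elem i j).tendsto A₀).comp hA).mul (tendsto_pi_nhds.1 hu j)

variable [DecidableEq ι]

theorem exists_mem_spectrum_norm_sub_pow_le [Nonempty ι] (A : Matrix ι ι ℂ) (ε : ℂ) :
    ∃ α ∈ spectrum ℂ A, ‖ε - α‖ ^ Fintype.card ι ≤ ‖A.charpoly.eval ε‖ := by
  have hsplits := IsAlgClosed.splits A.charpoly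
  have hcard : A.charpoly.roots.card = Fintype.card ι := by
    rw [← hsplits.natDegree_eq_card_roots, Matrix.charpoly_natDegree_eq_dim]
  obtain ⟨α, hα, hmin⟩ := Multiset.exists_min_image (fun α => ‖ε - α‖)
    (Multiset.card_pos.1 (hcard ▸ Fintype.card_pos))
  refine ⟨α, Matrix.mem_spectrum_of_isRoot_charpoly (Polynomial.isRoot_of_mem_roots hα), ?_⟩
  calc ‖ε - α‖ ^ Fintype.card ι = (A.charpoly.roots.map fun _ => ‖ε - α‖).prod := by
        rw [Multiset.map_const', Multiset.prod_replicate, hcard]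
    _ ≤ (A.charpoly.roots.map fun β => ‖ε - β‖).prod :=
        Multiset.prod_map_le_prod_map₀ _ _ (fun _ _ => norm_nonneg _) hmin
    _ = ‖A.charpoly.eval ε‖ := by
        rw [hsplits.eval_eq_prod_roots_of_monic A.charpoly_monic]
        exact Multiset.prod_hom' _ (normHom : ℂ →*₀ ℝ) _

theorem exists_tendsto_mem_spectrum {l : Filter X} {A : X → Matrix ι ι ℂ} {A₀ : Matrix ι ι ℂ}
    (hA : Tendsto A l (𝓝 A₀)) {ε : ℂ} (hε : ε ∈ spectrum ℂ A₀) :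
    ∃ α : X → ℂ, (∀ y, α y ∈ spectrum ℂ (A y)) ∧ Tendsto α l (𝓝 ε) := by
  obtain ⟨u, hu, -⟩ := mem_spectrum_iff_exists_mulVec_eq_smul.1 hε
  have : Nonempty ι := (Function.ne_iff.1 hu).nonempty
  choose α hα hle using fun y => exists_mem_spectrum_norm_sub_pow_le (A y) ε
  refine ⟨α, hα, Metric.tendsto_nhds.2 fun r hr => ?_⟩
  have hsmall : Tendsto (fun y => ‖(A y).charpoly.eval ε‖) l (𝓝 0) := by
    rw [← norm_zero (E := ℂ), ← (Matrix.mem_spectrum_iff_isRoot_charpoly.1 hε).eq_zero]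
    simp only [Matrix.eval_charpoly]
    exact ((continuous_const.sub continuous_id).matrix_det.norm.tendsto A₀).comp hA
  filter_upwards [hsmall.eventually_lt_const (pow_pos hr (Fintype.card ι))] with y hy
  rw [dist_comm, dist_eq_norm]
  exact lt_of_pow_lt_pow_left₀ _ hr.le ((hle y).trans_lt hy)

/-- The limit is taken along an ultrafilter, so that normalised eigenvectors converge without
extracting a subsequence. -/
theorem exists_tendsto_eigenvector {𝒰 : Ultrafilter X} {A : X → Matrix ι ι ℂ} {A₀ : Matrix ι ι ℂ}
    (hA : Tendsto A 𝒰 (𝓝 A₀)) {ε : ℂ} (hε : ε ∈ spectrum ℂ A₀) :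
    ∃ (α : X → ℂ) (u : X → ι → ℂ) (u₀ : ι → ℂ),
      (∀ y, u y ≠ 0 ∧ A y *ᵥ u y = α y • u y) ∧ Tendsto α 𝒰 (𝓝 ε) ∧
      Tendsto u 𝒰 (𝓝 u₀) ∧ u₀ ≠ 0 ∧ A₀ *ᵥ u₀ = ε • u₀ := by
  obtain ⟨α, hα, hαε⟩ := exists_tendsto_mem_spectrum hA hε
  have hunit : ∀ y, ∃ u, ‖u‖ = 1 ∧ A y *ᵥ u = α y • u := fun y => by
    obtain ⟨u, hu0, hu⟩ := mem_spectrum_iff_exists_mulVec_eq_smul.1 (hα y)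
    exact ⟨(‖u‖⁻¹ : ℂ) • u, norm_smul_inv_norm hu0, by rw [Matrix.mulVec_smul, hu, smul_comm]⟩
  choose u hu1 hu using hunit
  obtain ⟨u₀, hu₀, hlim⟩ := (isCompact_sphere (0 : ι → ℂ) 1).ultrafilter_le_nhds' (𝒰.map u)
    (Ultrafilter.mem_map.2 (univ_mem' fun y => mem_sphere_zero_iff_norm.2 (hu1 y)))
  have hu_lim : Tendsto u 𝒰 (𝓝 u₀) := hlim
  have hmul : Tendsto (fun y => A y *ᵥ u y) 𝒰 (𝓝 (A₀ *ᵥ u₀)) :=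
    tendsto_mulVec hA hu_lim
  exact ⟨α, u, u₀, fun y => ⟨ne_zero_of_norm_ne_zero (by simp [hu1]), hu y⟩, hαε, hu_lim,
    ne_zero_of_norm_ne_zero (by simp [mem_sphere_zero_iff_norm.1 hu₀]),
    tendsto_nhds_unique hmul ((hαε.smul hu_lim).congr fun y => (hu y).symm)⟩

end Spectrum

section Closure

theorem tendsto_quad {n : ℕ} {X : Type*} {l : Filter X}
    {W : X → Fin n → Fin n → Fin n → Fin n → ℝ} {W₀ : Fin n → Fin n → Fin n → Fin n → ℝ}
    {u v w z : X → Fin n → ℂ} {u₀ v₀ w₀ z₀ : Fin n → ℂ}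
    (hW : ∀ a b c d, Tendsto (fun y => W y a b c d) l (𝓝 (W₀ a b c d)))
    (hu : Tendsto u l (𝓝 u₀)) (hv : Tendsto v l (𝓝 v₀)) (hw : Tendsto w l (𝓝 w₀))
    (hz : Tendsto z l (𝓝 z₀)) :
    Tendsto (fun y => quad (W y) (u y) (v y) (w y) (z y)) l (𝓝 (quad W₀ u₀ v₀ w₀ z₀)) :=
  tendsto_finsetSum _ fun a _ => tendsto_finsetSum _ fun b _ =>
    tendsto_finsetSum _ fun c _ => tendsto_finsetSum _ fun d _ =>
      ((((Tendsto.comp (Complex.continuous_ofReal.tendsto _) (hW a b c d)).mul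
        (tendsto_pi_nhds.1 hu a)).mul (tendsto_pi_nhds.1 hv b)).mul
        (tendsto_pi_nhds.1 hw c)).mul (tendsto_pi_nhds.1 hz d)

theorem tendsto_complexify {ι κ X : Type*} {l : Filter X} {B : X → Matrix ι κ ℝ}
    {B₀ : Matrix ι κ ℝ} (hB : ∀ a b, Tendsto (fun y => B y a b) l (𝓝 (B₀ a b))) :
    Tendsto (fun y => (B y).map fun r : ℝ => (r : ℂ)) l (𝓝 (B₀.map fun r : ℝ => (r : ℂ))) :=
  tendsto_pi_nhds.2 fun a => tendsto_pi_nhds.2 fun b =>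
    (Complex.continuous_ofReal.tendsto _).comp (hB a b)

theorem quad_eq_zero_of_simpleOnTwoForms {m : ℕ} {G Φ : Matrix (Fin (2 * m)) (Fin (2 * m)) ℝ}
    {W : Fin (2 * m) → Fin (2 * m) → Fin (2 * m) → Fin (2 * m) → ℝ}
    (hG : G.IsSymm) (hΦ : Φᵀ = -Φ) (hd : NondegenerateDistinct G Φ) (hS : SimpleOnTwoForms G Φ)
    (hW : tensorAct (G⁻¹ * Φ) W = 0) (hleft : ∀ a b c d, W a b c d = -W b a c d)
    (hright : ∀ a b c d, W a b c d = -W a b d c) {α β γ δ : ℂ} {u v w z : Fin (2 * m) → ℂ}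
    (hu0 : u ≠ 0) (hu : IsEigen G Φ α u) (hv : IsEigen G Φ β v) (hw : IsEigen G Φ γ w)
    (hz : IsEigen G Φ δ z) (hαβ : α + β ≠ 0) (hαγ : α + γ ≠ 0) (hαδ : α + δ ≠ 0) :
    quad W u v w z = 0 := by
  obtain ⟨F⟩ := nonempty_nullDiagonalFrame hG hΦ hd
  obtain ⟨a, rfl⟩ : α ∈ Set.range F.ev := by
    rw [← F.eigenvalues_eq_range_ev, mem_eigenvalues_iff_exists_isEigen F.det_metric_ne_zero]
    exact ⟨u, hu0, hu⟩
  have haligned : F.Aligned W a :=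
    F.aligned_of_simpleOnTwoForms (F.ev_injective hd) hS hW hleft hright
  have horth {β v} (hv : IsEigen G Φ β v) (h : F.ev a + β ≠ 0) : bilin G (F.V a) v = 0 :=
    (F.isEigen a).bilin_eq_zero hG hΦ hv h
  have hsmul := quad_smul W (F.V a) v w z (bilin G (F.V a.swap) u) 1 1 1
  rw [haligned.quad_eq_zero (horth hv hαβ) (horth hw hαγ) (horth hz hαδ), mul_zero] at hsmul
  simpa only [one_smul, ← F.eq_bilin_smul_V_of_isEigen (F.ev_injective hd) hu] using hsmul

variable {m : ℕ} {U : Set (Coord (2 * m))}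
  {G Φ : Coord (2 * m) → Matrix (Fin (2 * m)) (Fin (2 * m)) ℝ} {x : Coord (2 * m)}

theorem aligned_of_mem_closure (hm : 2 ≤ m) (h : CKYOn G Φ U)
    (hd : ∀ y ∈ U, NondegenerateDistinct (G y) (Φ y)) (hx : x ∈ U)
    (hcl : x ∈ closure {y | y ∈ U ∧ SimpleOnTwoForms (G y) (Φ y)})
    (F : NullDiagonalFrame m (G x) (Φ x)) (a : Fin m ⊕ Fin m) : F.Aligned (weyl G x) a := by
  obtain ⟨𝒰, hsimple, hle⟩ := mem_closure_iff_ultrafilter.1 hcl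
  have hF := F.ev_injective (hd x hx)
  have hlim : Tendsto (fun y => complexify ((G y)⁻¹ * Φ y)) 𝒰
      (𝓝 (complexify ((G x)⁻¹ * Φ x))) := (tendsto_complexify fun i j =>
    ((h.smooth.inv h.det_ne_zero).mul h.smooth_form).tendsto h.isOpen hx i j).mono_left hle
  have hmem (b) : F.ev b ∈ eigenvalues (G x) (Φ x) :=
    F.eigenvalues_eq_range_ev ▸ Set.mem_range_self b
  choose α u u₀ hu hα hu_lim hu₀0 hu₀ using fun b => exists_tendsto_eigenvector hlim (hmem b)
  have hu₀V (b) : ∃ t : ℂ, t ≠ 0 ∧ u₀ b = t • F.V b := by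
    have hb := F.eq_bilin_smul_V_of_isEigen hF
      ((isEigen_iff_mulVec_raise (h.det_ne_zero x hx)).2 (hu₀ b))
    exact ⟨_, fun h0 => hu₀0 b (by rw [hb, h0, zero_smul]), hb⟩
  choose t ht0 ht using hu₀V
  intro b c d hb hc hd'
  have hsum {b} (hb : b ≠ a.swap) : ∀ᶠ y in 𝒰, α a y + α b y ≠ 0 :=
    ((hα a).add (hα b)).eventually_ne (F.ev_add_ne_zero hF hb)
  have hzero : ∀ᶠ y in 𝒰, quad (weyl G y) (u a y) (u b y) (u c y) (u d y) = 0 := by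
    filter_upwards [hsimple, hsum hb, hsum hc, hsum hd'] with y ⟨hy, hS⟩ hab hac had
    have heigen (b) : IsEigen (G y) (Φ y) (α b y) (u b y) :=
      (isEigen_iff_mulVec_raise (h.det_ne_zero y hy)).2 (hu b y).2
    exact quad_eq_zero_of_simpleOnTwoForms (h.isSymm y hy) (h.alt y hy) (hd y hy) hS
      (h.tensorAct_weyl (by omega) hy) (h.weyl_antisymm_left hy) weyl_antisymm_right (hu a y).1
      (heigen a) (heigen b) (heigen c) (heigen d) hab hac had
  have hquad := tendsto_quad (fun i j k l => (differentiableAt_of_contDiffOn h.isOpen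
    (h.contDiffOn_weyl i j k l) hx).continuousAt.tendsto.mono_left hle)
    (hu_lim a) (hu_lim b) (hu_lim c) (hu_lim d)
  have hzero₀ := tendsto_nhds_unique (hquad.congr' hzero) tendsto_const_nhds
  rw [ht a, ht b, ht c, ht d, quad_smul] at hzero₀
  exact (mul_eq_zero.1 hzero₀).resolve_left
    (mul_ne_zero (mul_ne_zero (mul_ne_zero (ht0 a) (ht0 b)) (ht0 c)) (ht0 d))

end Closure

section Manifold

variable {n : ℕ} {M : Type*} [TopologicalSpace M] [ChartedSpace (Coord n) M]

theorem TwoForm.form_swap (φ : TwoForm n M) (p : M) (X Y : TangentSpace (𝓡 n) p) :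
    φ.form p X Y = -φ.form p Y X := by
  have h := φ.alt p (X + Y)
  simp only [map_add, LinearMap.add_apply, φ.alt, zero_add, add_zero] at h
  linarith

theorem IsConformalKillingYano.ckyOn {g : Metric n M} {φ : TwoForm n M}
    (hφ : IsConformalKillingYano g φ) {e : OpenPartialHomeomorph M (Coord n)}
    (he : e ∈ atlas (Coord n) M) (hdet : ∀ y ∈ e.target, (comp g.form e y).det ≠ 0) :
    CKYOn (comp g.form e) (comp φ.form e) e.target where
  isOpen := e.open_target
  smooth := g.smooth e he
  isSymm _ _ := Matrix.ext fun _ _ => g.symm _ _ _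
  det_ne_zero := hdet
  smooth_form := φ.smooth e he
  alt _ _ := Matrix.ext fun _ _ => φ.form_swap _ _ _
  cky := hφ e he

end Manifold

end CKY

end

theorem mainTheorem4 (m : ℕ) (hm : 2 ≤ m) {M : Type*} [TopologicalSpace M]
    [ChartedSpace (CKY.Coord (2 * m)) M] [IsManifold (𝓡 (2 * m)) ∞ M]
    (g : CKY.Metric (2 * m) M) (φ : CKY.TwoForm (2 * m) M)
    (hφ : CKY.IsConformalKillingYano g φ)
    (hdist : ∀ e ∈ atlas (CKY.Coord (2 * m)) M, ∀ x ∈ e.target,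
      CKY.NondegenerateDistinct (CKY.comp g.form e x) (CKY.comp φ.form e x))
    (e : OpenPartialHomeomorph M (CKY.Coord (2 * m)))
    (he : e ∈ atlas (CKY.Coord (2 * m)) M)
    (x : CKY.Coord (2 * m)) (hx : x ∈ e.target) :
    -- arbitrary signature, all vectors of the complex null frame
    (x ∈ closure {y | y ∈ e.target ∧
        CKY.SimpleOnTwoForms (CKY.comp g.form e y) (CKY.comp φ.form e y)} →
      ∀ F : CKY.NullDiagonalFrame m (CKY.comp g.form e x) (CKY.comp φ.form e x),
        (∀ a, CKY.IsWAND (CKY.comp g.form e x) (CKY.weyl (CKY.comp g.form e) x) (F.V a)) ∧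
        (∀ μ, CKY.IsTypeDPair (CKY.comp g.form e x) (CKY.weyl (CKY.comp g.form e) x)
          (F.V (Sum.inl μ)) (F.V (Sum.inr μ)))) ∧
    -- Lorentzian signature, real null directions
    (CKY.IsLorentzian (CKY.comp g.form e x) →
      (∀ F : CKY.NullDiagonalFrame m (CKY.comp g.form e x) (CKY.comp φ.form e x),
        (∃ μ, CKY.IsRealDirection (F.V (Sum.inl μ)) ∧ CKY.IsRealDirection (F.V (Sum.inr μ)) ∧
          CKY.IsTypeDPair (CKY.comp g.form e x) (CKY.weyl (CKY.comp g.form e) x)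
            (F.V (Sum.inl μ)) (F.V (Sum.inr μ))) ∧
        (∀ a, CKY.IsRealDirection (F.V a) →
          CKY.IsWAND (CKY.comp g.form e x) (CKY.weyl (CKY.comp g.form e) x) (F.V a))) ∧
      (CKY.weyl (CKY.comp g.form e) x = 0 ∨
        CKY.IsTypeD (CKY.comp g.form e x) (CKY.weyl (CKY.comp g.form e) x))) := by
  have hd := hdist e he
  have h := hφ.ckyOn he fun y hy => (hd y hy).det_metric_ne_zero (by omega)
  have hW := h.tensorAct_weyl (by omega) hx
  have hleft := h.weyl_antisymm_left hx
  refine ⟨fun hcl F => ?_, fun hL => ?_⟩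
  · have hF := CKY.aligned_of_mem_closure hm h hd hx hcl F
    exact ⟨fun a => (hF a).isWAND,
      fun μ => (hF (Sum.inl μ)).isTypeDPair (hF _) (F.ev_injective (hd x hx)) hW⟩
  · have hpair (F : CKY.NullDiagonalFrame m (CKY.comp g.form e x) (CKY.comp φ.form e x)) :=
      F.exists_isRealDirection_isTypeDPair (F.ev_injective (hd x hx)) hL (by omega) hW hleft
        CKY.weyl_antisymm_right
    refine ⟨fun F => ⟨hpair F, fun a ha => ?_⟩, or_iff_not_imp_left.2 fun hweyl => ?_⟩
    · have hre := F.re_ev_ne_zero_of_isRealDirection (F.ev_injective (hd x hx)) ha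
      exact (F.aligned_of_re_ev_ne_zero hL hW hleft CKY.weyl_antisymm_right hre).isWAND
    · obtain ⟨F⟩ := CKY.nonempty_nullDiagonalFrame (h.isSymm x hx) (h.alt x hx) (hd x hx)
      obtain ⟨μ, hreal, hreal', hD⟩ := hpair F
      exact hD.isTypeD hweyl hreal hreal'
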